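/- Let $d\ge 1$, let $\Omega\subset\mathbb{R}^d$ be a bounded polyhedral domain, and let $a,b$ be measurable, symmetric $d\times d$ matrix valued coefficients on $\Omega$ with $\lambda_a(x)|\xi|^2\le \xi^Ta(x)\xi\le\Lambda_a(x)|\xi|^2$ and $\lambda_b(x)|\xi|^2\le \xi^Tb(x)\xi\le\Lambda_b(x)|\xi|^2$ for all $\xi\in\mathbb{R}^d$, where $\lambda_a,\lambda_b$ are bounded below by a positive constant and $\Lambda_a,\Lambda_b$ are bounded above. For a conforming simplicial triangulation $\mathcal{T}$ of $\Omega$ with mesh size $h$ (the largest diameter of a simplex), let $\mathbb{V}_{\mathcal{T}}$ be the space of continuous piecewise linear functions vanishing on $\partial\Omega$, with nodal basis $(\phi_i)$, let $$M_{ij}=(\phi_i,\phi_j),\qquad A_{ij}=(a\nabla\phi_i,\nabla\phi_j),\qquad B_{ij}=(b\nabla\phi_i,\nabla\phi_j)$$ with the $L^2(\Omega)$ inner product, and let $\bar M$ be the lumped mass matrix, i.e. the diagonal matrix whose diagonal entries are the row sums of $M$. For $\tau>0$ put $$\mathcal{A}=\begin{pmatrix}\tau A& M\\ M&-\tau B\end{pmatrix},\qquad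 \mathcal{B}=\begin{pmatrix}\tau A&\bar M\\ \bar M&-\tau B\end{pmatrix},\qquad E=I-\mathcal{B}^{-1}\mathcal{A},\qquad \theta=\frac{\rho(\mathcal{B}^{-1}\mathcal{A})}{2},$$ where $\rho$ denotes the spectral radius. For every shape-regularity constant $\sigma$ there is a constant $C>0$, independent of $h$ and $\tau$ (depending only on $d,\Omega,a,b,\sigma$), such that for every shape-regular triangulation $\mathcal{T}$ of $\Omega$ with constant $\sigma$ (every $d$-dimensional simplex $K$ contains a ball of radius $r$ with $\operatorname{diam}K\le\sigma r$) and every $\tau\ge Ch^2$, $\tau>0$, the following holds. The matrix $\mathcal{B}$ is invertible, $\theta<1$ and $\rho(E)<1$. Moreover, if GMRes (started from any initial iterate $v_0$) is applied to the right-preconditioned system $\mathcal{A}\mathcal{B}^{-1}v=f$ with any right-hand side $f$, and $v_k$ are its iterates and $r_k=f-\mathcal{A}\mathcal{B}^{-1}v_k$ its residuals, then GMRes converges with asymptotic linear rate bounded by $\theta$, $$\limsup_{k\to\infty}\left(\frac{\|r_k\|_2}{\|r_0\|_2}\right)^{1/k}\le\theta ,$$ and for all $k\ge 0$ $$\|r_k\|_2\le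 C_0\,\theta^k\,\|r_0\|_2,\qquad C_0=\frac{2^{m-1}C_R^m\,(1+\rho(E))\,\dim\mathbb{V}_{\mathcal{T}}}{(1-\rho(E))^m}.$$ Here $V$ is any nonsingular complex matrix that transforms $R=\mathcal{A}\mathcal{B}^{-1}$ into Jordan canonical form $J=V^{-1}RV$, $\kappa(V)=\|V\|_2\|V^{-1}\|_2$, $n=2\dim\mathbb{V}_{\mathcal{T}}$ is the order of $R$, $p$ is the number of Jordan blocks, $m$ is the size of the largest Jordan block, and $C_R=n(1+\sqrt{n-p})\,\kappa(V)$. The asymptotic rate for $r_0=0$ is read as $0$. -/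

import Mathlib

noncomputable section

open MeasureTheory Matrix

namespace FourthOrderFEM

/-! ## Triangulations and the piecewise linear finite element space -/

/-- The space `ℝᵈ` with its Euclidean norm. -/
abbrev Space (d : ℕ) : Type := EuclideanSpace ℝ (Fin d)

/-- A conforming simplicial triangulation of the open set `Ω ⊆ ℝᵈ`: a finite geometric simplicial
complex, all of whose simplices are faces of `d`-dimensional ones, that fills the closure of `Ω`
and resolves the boundary of `Ω` (the boundary is a union of simplices of the complex). -/
structure Triangulation {d : ℕ} (Ω : Set (Space d)) where
  complex : Geometry.SimplicialComplex ℝ (Space d)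
  finite_faces : complex.faces.Finite
  pure_dim : ∀ s ∈ complex.faces, ∃ t ∈ complex.faces, s ⊆ t ∧ t.card = d + 1
  space_eq : complex.space = closure Ω
  frontier_resolved : ∀ x ∈ frontier Ω, ∃ s ∈ complex.faces,
    x ∈ convexHull ℝ (s : Set (Space d)) ∧ convexHull ℝ (s : Set (Space d)) ⊆ frontier Ω

/-- `w` is the vector of barycentric coordinates of `x` with respect to the vertices of the
closed simplex `s`, extended by zero to all other points. -/
def IsBarycentric {d : ℕ} (s : Finset (Space d)) (w : Space d → ℝ) (x : Space d) : Prop :=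
  (∀ y ∈ s, 0 ≤ w y) ∧ (∀ y, y ∉ s → w y = 0) ∧ ∑ y ∈ s, w y = 1 ∧ ∑ y ∈ s, w y • y = x

namespace Triangulation

variable {d : ℕ} {Ω : Set (Space d)} (T : Triangulation Ω)

/-- The mesh size `h`, the largest diameter of a simplex. -/
def meshSize : ℝ :=
  sSup ((fun s : Finset (Space d) => Metric.diam (convexHull ℝ (s : Set (Space d)))) ''
    T.complex.faces)

/-- Shape regularity with constant `σ`: every `d`-dimensional simplex `K` contains a ball of
radius `r` with `diam K ≤ σ r`. -/
def IsShapeRegular (σ : ℝ) : Prop :=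
  ∀ s ∈ T.complex.faces, s.card = d + 1 → ∃ (c : Space d) (r : ℝ), 0 < r ∧
    Metric.closedBall c r ⊆ convexHull ℝ (s : Set (Space d)) ∧
    Metric.diam (convexHull ℝ (s : Set (Space d))) ≤ σ * r

/-- The finite element space: continuous functions that are affine on every simplex and satisfy
the homogeneous Dirichlet condition. Functions are extended by zero outside `Ω`. -/
def feSpace : Submodule ℝ (Space d → ℝ) where
  carrier := {u | Continuous u ∧ (∀ x, x ∉ Ω → u x = 0) ∧
    ∀ s ∈ T.complex.faces, ∃ g : Space d →ᵃ[ℝ] ℝ,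
      Set.EqOn u g (convexHull ℝ (s : Set (Space d)))}
  zero_mem' := ⟨continuous_const, fun _ _ => rfl, fun _ _ => ⟨0, fun _ _ => rfl⟩⟩
  add_mem' := by
    rintro u v ⟨hu, hu', hu''⟩ ⟨hv, hv', hv''⟩
    refine ⟨hu.add hv, fun x hx => by simp [hu' x hx, hv' x hx], fun s hs => ?_⟩
    obtain ⟨g, hg⟩ := hu'' s hs
    obtain ⟨k, hk⟩ := hv'' s hs
    exact ⟨g + k, fun x hx => by simp [hg hx, hk hx]⟩
  smul_mem' := by
    rintro c u ⟨hu, hu', hu''⟩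
    refine ⟨hu.const_smul c, fun x hx => by simp [hu' x hx], fun s hs => ?_⟩
    obtain ⟨g, hg⟩ := hu'' s hs
    exact ⟨c • g, fun x hx => by simp [hg hx]⟩

/-- The degrees of freedom: the vertices of the triangulation that lie in `Ω`. -/
def Node : Type := {z : Space d // z ∈ T.complex.vertices ∧ z ∈ Ω}

instance : DecidableEq T.Node := Classical.decEq _

instance : Finite T.Node := by
  have hfin : T.complex.vertices.Finite := by
    have : T.complex.vertices =
        (fun z : Space d => ({z} : Finset (Space d))) ⁻¹' T.complex.faces := rfl
    rw [this]
    exact T.finite_faces.preimage (Finset.singleton_injective.injOn)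
  exact (hfin.subset fun _ hz => hz.1).to_subtype

instance : Fintype T.Node := Fintype.ofFinite _

open Classical in
/-- The barycentric coordinates of `x` in the simplices of the triangulation that contain it
(they do not depend on the simplex); zero if `x` is not covered. -/
def barycentric (x : Space d) : Space d → ℝ :=
  if h : ∃ w : Space d → ℝ, ∃ s ∈ T.complex.faces, IsBarycentric s w x then h.choose else 0

/-- The nodal basis function of the vertex `z`: on each simplex containing `z` it is the
barycentric coordinate of `z`, and it vanishes elsewhere. -/
def hat (z : T.Node) (x : Space d) : ℝ := T.barycentric x z.1

/-- The mass matrix `M`, with entries `(φᵢ, φⱼ)`. -/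
def mass : Matrix T.Node T.Node ℝ := Matrix.of fun i j => ∫ x in Ω, T.hat i x * T.hat j x

/-- The stiffness matrix with entries `(a ∇φᵢ, ∇φⱼ)`. The gradient is the classical one, which
exists in the interior of every `d`-dimensional simplex, hence almost everywhere, and coincides
there with the weak gradient. -/
def stiffness (a : Space d → Matrix (Fin d) (Fin d) ℝ) : Matrix T.Node T.Node ℝ :=
  Matrix.of fun i j => ∫ x in Ω,
    (a x *ᵥ (gradient (T.hat i) x).ofLp) ⬝ᵥ (gradient (T.hat j) x).ofLp

/-- The lumped mass matrix: diagonal, its diagonal entries are the row sums of `M`. -/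
def lumpedMass : Matrix T.Node T.Node ℝ := Matrix.diagonal fun i => ∑ j, T.mass i j

/-- The system matrix `𝒜 = [[τA, M], [M, -τB]]`. -/
def systemMatrix (a b : Space d → Matrix (Fin d) (Fin d) ℝ) (τ : ℝ) :
    Matrix (T.Node ⊕ T.Node) (T.Node ⊕ T.Node) ℝ :=
  Matrix.fromBlocks (τ • T.stiffness a) T.mass T.mass (-(τ • T.stiffness b))

/-- The mass lumping preconditioner `ℬ = [[τA, M̄], [M̄, -τB]]`. -/
def preconditioner (a b : Space d → Matrix (Fin d) (Fin d) ℝ) (τ : ℝ) :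
    Matrix (T.Node ⊕ T.Node) (T.Node ⊕ T.Node) ℝ :=
  Matrix.fromBlocks (τ • T.stiffness a) T.lumpedMass T.lumpedMass (-(τ • T.stiffness b))

end Triangulation

/-- Admissible diffusion coefficients on `Ω`: measurable, symmetric matrix valued, uniformly
elliptic and bounded, `λ(x)|ξ|² ≤ ξᵀ a(x) ξ ≤ Λ(x)|ξ|²` with `λ` bounded below by a positive
constant and `Λ` bounded above. -/
structure IsDiffusionCoefficient {d : ℕ} (Ω : Set (Space d))
    (a : Space d → Matrix (Fin d) (Fin d) ℝ) : Prop where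
  aemeasurable : ∀ i j, AEMeasurable (fun x => a x i j) (volume.restrict Ω)
  symm : ∀ᵐ x ∂(volume.restrict Ω), (a x).IsSymm
  elliptic : ∃ lo hi : ℝ, 0 < lo ∧ ∀ᵐ x ∂(volume.restrict Ω), ∀ ξ : Fin d → ℝ,
    lo * (ξ ⬝ᵥ ξ) ≤ ξ ⬝ᵥ (a x *ᵥ ξ) ∧ ξ ⬝ᵥ (a x *ᵥ ξ) ≤ hi * (ξ ⬝ᵥ ξ)

/-! ## Spectral radius, Jordan form, GMRes -/

section LinearAlgebra

variable {n : Type} [Fintype n] [DecidableEq n]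

/-- The spectral radius (largest modulus of a complex eigenvalue) of a real square matrix. -/
def rho (R : Matrix n n ℝ) : ℝ := (spectralRadius ℂ (R.map ((↑) : ℝ → ℂ))).toReal

/-- The Euclidean norm of a real vector. -/
def euclNorm (v : n → ℝ) : ℝ := ‖(WithLp.toLp 2 v : EuclideanSpace ℝ n)‖

/-- The condition number `‖V‖₂ ‖V⁻¹‖₂` in the spectral norm. -/
def condNumber (V : Matrix n n ℂ) : ℝ :=
  ‖Matrix.toEuclideanCLM (n := n) (𝕜 := ℂ) V‖ * ‖Matrix.toEuclideanCLM (n := n) (𝕜 := ℂ) V⁻¹‖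

/-- The `k × k` Jordan block with eigenvalue `μ` and ones on the superdiagonal. -/
def jordanBlock (μ : ℂ) (k : ℕ) : Matrix (Fin k) (Fin k) ℂ :=
  Matrix.of fun i j => if i = j then μ else if (i : ℕ) + 1 = (j : ℕ) then 1 else 0

/-- A transformation of the real matrix `R` to Jordan canonical form: `V` is nonsingular and
`V⁻¹ R V` is block diagonal with `p` Jordan blocks (`e` numbers the basis vectors block by
block). -/
structure JordanTransform (R : Matrix n n ℝ) where
  p : ℕ
  size : Fin p → ℕ
  size_pos : ∀ i, 0 < size i
  eig : Fin p → ℂ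
  e : (Σ i, Fin (size i)) ≃ n
  V : Matrix n n ℂ
  isUnit_det : IsUnit V.det
  conj_eq : V⁻¹ * R.map ((↑) : ℝ → ℂ) * V =
    Matrix.reindex e e (Matrix.blockDiagonal' fun i => jordanBlock (eig i) (size i))

namespace JordanTransform

variable {R : Matrix n n ℝ} (J : JordanTransform R)

/-- The size `m` of the largest Jordan block. -/
def m : ℕ := Finset.univ.sup J.size

/-- The constant `C_R = n (1 + √(n - p)) κ(V)`, where `n` is the order of `R`. -/
def CR : ℝ :=
  (Fintype.card n : ℝ) * (1 + Real.sqrt ((Fintype.card n : ℝ) - (J.p : ℝ))) * condNumber J.V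

end JordanTransform

/-- The Krylov space `span {r, R r, …, R^(k-1) r}`. -/
def krylov (R : Matrix n n ℝ) (r : n → ℝ) (k : ℕ) : Submodule ℝ (n → ℝ) :=
  Submodule.span ℝ (Set.range fun i : Fin k => (R ^ (i : ℕ)) *ᵥ r)

/-- `v` is the sequence of (exact arithmetic, unrestarted) GMRes iterates for `R x = f` with
initial iterate `v 0`: `v k` minimises the Euclidean norm of the residual over the affine space
`v 0 + krylov R r₀ k`, where `r₀ = f - R (v 0)`. -/
def IsGMRes (R : Matrix n n ℝ) (f : n → ℝ) (v : ℕ → n → ℝ) : Prop :=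
  ∀ k, v k - v 0 ∈ krylov R (f - R *ᵥ v 0) k ∧
    ∀ w : n → ℝ, w - v 0 ∈ krylov R (f - R *ᵥ v 0) k →
      euclNorm (f - R *ᵥ v k) ≤ euclNorm (f - R *ᵥ w)

end LinearAlgebra

/-- The asymptotic linear convergence rate `limsup (‖r_k‖ / ‖r₀‖)^(1/k)` of a sequence of
residual norms. -/
def asymptoticRate (r : ℕ → ℝ) : ENNReal :=
  Filter.limsup (fun k : ℕ => ENNReal.ofReal ((r k / r 0) ^ ((1 : ℝ) / (k : ℝ)))) Filter.atTop

end FourthOrderFEM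

end

noncomputable section

open MeasureTheory Matrix

/-! Let `D = M̄ - M` be the lumping error. Since `M̄` carries the row sums of the symmetric,
entrywise nonnegative matrix `M`, one has `vᵀDv = ½ ∑ Mᵢⱼ (vᵢ - vⱼ)²`. Let `u` have nodal values
`v`. On one simplex nodal differences are at most `h |∇u|`, and the nodal basis functions sum to at
most one, so `0 ≤ vᵀDv ≤ (h²/2) ∫ |∇u|²` (`dotProduct_lumping_error_le`). Ellipticity turns this
into `D ≤ τA/12` and `D ≤ τB/12` once `τ ≥ C h²`.

An eigenpair `(l, (p, q))` of `E` satisfies `Dq = l (τA p + M̄ q)` and `Dp = l (M̄ p - τB q)`.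
Testing with `p` and `q` and subtracting leaves `p*Dq - q*Dp = l (Q + i s)` with `s` real and `Q =
p*τAp + q*τBq > 0`. The left side has modulus at most `p*Dp + q*Dq ≤ Q/12`, hence `|l| ≤ 1/12`
(`norm_le_of_saddle_pencil`). Thus `ρ(E) ≤ 1/12`, every eigenvalue of `ℬ⁻¹𝒜` is within `1/12` of
`1`, and `11/24 ≤ θ ≤ 13/24` when there is at least one node.

GMRes does no worse than Richardson iteration, so `‖r_k‖ ≤ ‖(1 - R)ᵏ r₀‖` with `R = 𝒜ℬ⁻¹` similar to
`ℬ⁻¹𝒜`. Gelfand's formula gives the asymptotic rate. For the explicit bound the Jordan basis is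
rescaled so that the superdiagonal entries have modulus `1/3`. This yields `κ(V) 3^(m-1) (1/12 +
1/3)ᵏ` (`norm_one_sub_pow_le`), where `5/12 < 11/24 ≤ θ`, and `C₀` exceeds `κ(V) 3^(m-1)`. -/

namespace FourthOrderFEM

/-! ### Complex quadratic forms and the saddle point pencil -/

section QuadraticForms

variable {ι : Type} [Fintype ι]

/-- The complex sesquilinear form `(p, q) ↦ p* S q` of a real matrix `S`. -/
def sesq (S : Matrix ι ι ℝ) (p q : ι → ℂ) : ℂ :=
  star p ⬝ᵥ (S.map ((↑) : ℝ → ℂ) *ᵥ q)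

theorem mulVec_dotProduct_comm {S : Matrix ι ι ℝ} (hS : S.IsSymm) (x y : ι → ℝ) :
    x ⬝ᵥ (S *ᵥ y) = y ⬝ᵥ (S *ᵥ x) := by
  rw [dotProduct_mulVec, ← mulVec_transpose, hS.eq, dotProduct_comm]

theorem sesq_eq (S : Matrix ι ι ℝ) (p q : ι → ℂ) :
    sesq S p q =
      (((fun i => (p i).re) ⬝ᵥ (S *ᵥ fun i => (q i).re)
        + (fun i => (p i).im) ⬝ᵥ (S *ᵥ fun i => (q i).im) : ℝ) : ℂ)
      + (((fun i => (p i).re) ⬝ᵥ (S *ᵥ fun i => (q i).im)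
        - (fun i => (p i).im) ⬝ᵥ (S *ᵥ fun i => (q i).re) : ℝ) : ℂ) * Complex.I := by
  apply Complex.ext <;>
  simp [sesq, dotProduct, mulVec, Finset.mul_sum, ← Finset.sum_add_distrib,
      ← Finset.sum_sub_distrib]
  refine Finset.sum_congr rfl fun i _ => ?_
  ring_nf
  exact Finset.sum_congr rfl fun j _ => by ring

theorem sesq_self {S : Matrix ι ι ℝ} (hS : S.IsSymm) (p : ι → ℂ) :
    sesq S p p = (((fun i => (p i).re) ⬝ᵥ (S *ᵥ fun i => (p i).re)
        + (fun i => (p i).im) ⬝ᵥ (S *ᵥ fun i => (p i).im) : ℝ) : ℂ) := by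
  rw [sesq_eq, mulVec_dotProduct_comm hS (fun i => (p i).im) (fun i => (p i).re)]
  simp

theorem sesq_sub_swap {S : Matrix ι ι ℝ} (hS : S.IsSymm) (p q : ι → ℂ) :
    sesq S p q - sesq S q p = ((2 * (sesq S p q).im : ℝ) : ℂ) * Complex.I := by
  rw [sesq_eq S p q, sesq_eq S q p, mulVec_dotProduct_comm hS (fun i => (q i).re),
    mulVec_dotProduct_comm hS (fun i => (q i).im),
    mulVec_dotProduct_comm hS (fun i => (q i).re) (fun i => (p i).im),
    mulVec_dotProduct_comm hS (fun i => (q i).im) (fun i => (p i).re)]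
  apply Complex.ext <;> simp
  ring

/-- The imaginary part is `Re p · S Im q - Im p · S Re q`. Each term obeys `2 |x · S y| ≤ x · S x +
y · S y`, by positivity at `x ± y`. -/
theorem two_mul_abs_im_sesq_le {S : Matrix ι ι ℝ} (hS : S.IsSymm)
    (h0 : ∀ x : ι → ℝ, 0 ≤ x ⬝ᵥ (S *ᵥ x)) (p q : ι → ℂ) :
    |2 * (sesq S p q).im| ≤ (sesq S p p).re + (sesq S q q).re := by
  have key : ∀ x y : ι → ℝ, 0 ≤ x ⬝ᵥ (S *ᵥ x) + y ⬝ᵥ (S *ᵥ y) + 2 * (x ⬝ᵥ (S *ᵥ y)) ∧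
      0 ≤ x ⬝ᵥ (S *ᵥ x) + y ⬝ᵥ (S *ᵥ y) - 2 * (x ⬝ᵥ (S *ᵥ y)) := by
    intro x y
    have h1 := h0 (x + y)
    have h2 := h0 (x - y)
    simp only [mulVec_add, mulVec_sub, dotProduct_add, add_dotProduct, dotProduct_sub,
      sub_dotProduct, mulVec_dotProduct_comm hS y x] at h1 h2
    constructor <;> linarith
  have e1 := key (fun i => (p i).re) (fun i => (q i).im)
  have e2 := key (fun i => (p i).im) (fun i => (q i).re)
  rw [sesq_self hS, sesq_self hS, sesq_eq S p q, abs_le]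
  simp only [Complex.ofReal_re, Complex.add_im, Complex.ofReal_im, Complex.mul_im, Complex.I_re,
    Complex.I_im, mul_zero, mul_one, zero_add, add_zero]
  constructor <;> linarith [e1.1, e1.2, e2.1, e2.2]

theorem re_sesq_self_pos {S : Matrix ι ι ℝ} (hS : S.IsSymm)
    (h0 : ∀ x : ι → ℝ, x ≠ 0 → 0 < x ⬝ᵥ (S *ᵥ x)) {p : ι → ℂ} (hp : p ≠ 0) :
    0 < (sesq S p p).re := by
  have h0' : ∀ x : ι → ℝ, 0 ≤ x ⬝ᵥ (S *ᵥ x) := fun x => by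
    rcases eq_or_ne x 0 with rfl | hx
    · simp
    · exact (h0 x hx).le
  rw [sesq_self hS, Complex.ofReal_re]
  by_cases hr : (fun i => (p i).re) = 0
  · have hi : (fun i => (p i).im) ≠ 0 := fun hi => hp <| funext fun i =>
      Complex.ext (congrFun hr i) (congrFun hi i)
    linarith [h0 _ hi, h0' fun i => (p i).re]
  · linarith [h0 _ hr, h0' fun i => (p i).im]

theorem re_sesq_self_le {S U : Matrix ι ι ℝ} (hS : S.IsSymm) (hU : U.IsSymm) {c : ℝ}
    (h : ∀ x : ι → ℝ, x ⬝ᵥ (S *ᵥ x) ≤ c * (x ⬝ᵥ (U *ᵥ x))) (p : ι → ℂ) :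
    (sesq S p p).re ≤ c * (sesq U p p).re := by
  rw [sesq_self hS, sesq_self hU, Complex.ofReal_re, Complex.ofReal_re]
  linarith [h fun i => (p i).re, h fun i => (p i).im]

/-- If `D` is dominated by `c A` and `c B`, the pencil with blocks `(0, D; D, 0)` and
`(A, L; L, -B)` only has eigenvalues of modulus at most `c`. -/
theorem norm_le_of_saddle_pencil {A B D L : Matrix ι ι ℝ} (hA : A.IsSymm) (hB : B.IsSymm)
    (hD : D.IsSymm) (hL : L.IsSymm) (hA0 : ∀ x : ι → ℝ, x ≠ 0 → 0 < x ⬝ᵥ (A *ᵥ x))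
    (hB0 : ∀ x : ι → ℝ, x ≠ 0 → 0 < x ⬝ᵥ (B *ᵥ x)) (hD0 : ∀ x : ι → ℝ, 0 ≤ x ⬝ᵥ (D *ᵥ x))
    {c : ℝ} (hDA : ∀ x : ι → ℝ, x ⬝ᵥ (D *ᵥ x) ≤ c * (x ⬝ᵥ (A *ᵥ x)))
    (hDB : ∀ x : ι → ℝ, x ⬝ᵥ (D *ᵥ x) ≤ c * (x ⬝ᵥ (B *ᵥ x))) {l : ℂ} {p q : ι → ℂ}
    (hpq : p ≠ 0 ∨ q ≠ 0)
    (h1 : D.map ((↑) : ℝ → ℂ) *ᵥ q =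
      l • (A.map ((↑) : ℝ → ℂ) *ᵥ p + L.map ((↑) : ℝ → ℂ) *ᵥ q))
    (h2 : D.map ((↑) : ℝ → ℂ) *ᵥ p =
      l • (L.map ((↑) : ℝ → ℂ) *ᵥ p - B.map ((↑) : ℝ → ℂ) *ᵥ q)) : ‖l‖ ≤ c := by
  have e1 : sesq D p q = l * (sesq A p p + sesq L p q) := by
    simp only [sesq, h1, dotProduct_smul, dotProduct_add, smul_eq_mul]
  have e2 : sesq D q p = l * (sesq L q p - sesq B q q) := by
    simp only [sesq, h2, dotProduct_smul, dotProduct_sub, smul_eq_mul]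
  have hre : ∀ {S : Matrix ι ι ℝ}, S.IsSymm → ∀ x : ι → ℂ,
      sesq S x x = ((sesq S x x).re : ℂ) := fun hS x => by
    rw [sesq_self hS, Complex.ofReal_re]
  set Q : ℝ := (sesq A p p).re + (sesq B q q).re with hQ
  have hnn : ∀ {S : Matrix ι ι ℝ}, S.IsSymm → (∀ x : ι → ℝ, x ≠ 0 → 0 < x ⬝ᵥ (S *ᵥ x)) →
      ∀ x : ι → ℂ, 0 ≤ (sesq S x x).re := fun hS h x => by
    rcases eq_or_ne x 0 with rfl | hx
    · simp [sesq]
    · exact (re_sesq_self_pos hS h hx).le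
  have hQ0 : 0 < Q := by
    rcases hpq with h | h
    · linarith [re_sesq_self_pos hA hA0 h, hnn hB hB0 q]
    · linarith [re_sesq_self_pos hB hB0 h, hnn hA hA0 p]
  -- Subtracting the two tested equations makes the `A` and `B` terms add up to the real number `Q`,
  -- while the `L` terms combine to a purely imaginary number.
  have e3 : ((2 * (sesq D p q).im : ℝ) : ℂ) * Complex.I =
      l * ((Q : ℂ) + ((2 * (sesq L p q).im : ℝ) : ℂ) * Complex.I) := by
    rw [← sesq_sub_swap hD, ← sesq_sub_swap hL, e1, e2, hQ]
    push_cast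
    rw [← hre hA, ← hre hB]
    ring
  have e4 := congrArg norm e3
  rw [norm_mul, norm_mul, Complex.norm_I, mul_one, Complex.norm_real, Real.norm_eq_abs] at e4
  have e5 : Q ≤ ‖(Q : ℂ) + ((2 * (sesq L p q).im : ℝ) : ℂ) * Complex.I‖ := by
    refine le_trans (le_of_eq ?_) (Complex.re_le_norm _)
    simp
  have e6 : |2 * (sesq D p q).im| ≤ c * Q := by
    have := two_mul_abs_im_sesq_le hD hD0 p q
    have := re_sesq_self_le hD hA hDA p
    have := re_sesq_self_le hD hB hDB q
    rw [hQ, mul_add]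
    linarith
  have e7 : ‖l‖ * Q ≤ c * Q := by
    rw [e4] at e6
    exact (mul_le_mul_of_nonneg_left e5 (norm_nonneg _)).trans e6
  exact le_of_mul_le_mul_right e7 hQ0

theorem saddle_mulVec_eq_zero {A B L : Matrix ι ι ℝ} (hL : L.IsSymm)
    (hA0 : ∀ x : ι → ℝ, x ≠ 0 → 0 < x ⬝ᵥ (A *ᵥ x))
    (hB0 : ∀ x : ι → ℝ, x ≠ 0 → 0 < x ⬝ᵥ (B *ᵥ x)) {x : ι ⊕ ι → ℝ}
    (hx : Matrix.fromBlocks A L L (-B) *ᵥ x = 0) : x = 0 := by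
  set p := x ∘ Sum.inl with hp
  set q := x ∘ Sum.inr with hq
  rw [fromBlocks_mulVec] at hx
  have h1 : A *ᵥ p + L *ᵥ q = 0 := funext fun i => congrFun hx (Sum.inl i)
  have h2 : L *ᵥ p + (-B) *ᵥ q = 0 := funext fun i => congrFun hx (Sum.inr i)
  have e1 := congrArg (p ⬝ᵥ ·) h1
  have e2 := congrArg (q ⬝ᵥ ·) h2
  simp only [dotProduct_add, neg_mulVec, dotProduct_neg, dotProduct_zero] at e1 e2
  have e3 := mulVec_dotProduct_comm hL p q
  have hnn : ∀ {S : Matrix ι ι ℝ}, (∀ x : ι → ℝ, x ≠ 0 → 0 < x ⬝ᵥ (S *ᵥ x)) →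
      ∀ x : ι → ℝ, 0 ≤ x ⬝ᵥ (S *ᵥ x) := fun h x => by
    rcases eq_or_ne x 0 with rfl | hx
    · simp
    · exact (h x hx).le
  have hA1 := hnn hA0 p
  have hB1 := hnn hB0 q
  -- By symmetry of `L` the coupling terms in `e1` and `e2` agree, so `p · A p + q · B q = 0` with
  -- both summands nonnegative.
  have hp0 : p = 0 := by
    by_contra h
    linarith [hA0 p h]
  have hq0 : q = 0 := by
    by_contra h
    linarith [hB0 q h]
  funext i
  rcases i with i | i
  · exact congrFun hp0 i
  · exact congrFun hq0 i

end QuadraticForms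

/-! ### Eigenvalues and the spectral radius -/

section SpectralRadius

variable {n : Type} [Fintype n] [DecidableEq n]

theorem exists_mulVec_eq_smul_of_mem_spectrum {X : Matrix n n ℂ} {l : ℂ}
    (hl : l ∈ spectrum ℂ X) : ∃ x : n → ℂ, x ≠ 0 ∧ X *ᵥ x = l • x := by
  rw [spectrum.mem_iff, Matrix.isUnit_iff_isUnit_det, isUnit_iff_ne_zero, not_not,
    ← Matrix.exists_mulVec_eq_zero_iff] at hl
  obtain ⟨x, hx, h⟩ := hl
  refine ⟨x, hx, ?_⟩
  rw [sub_mulVec, sub_eq_zero, Algebra.algebraMap_eq_smul_one, smul_mulVec, one_mulVec] at h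
  exact h.symm

theorem mem_spectrum_of_mulVec_eq_smul {X : Matrix n n ℂ} {l : ℂ} {x : n → ℂ} (hx : x ≠ 0)
    (h : X *ᵥ x = l • x) : l ∈ spectrum ℂ X := by
  rw [spectrum.mem_iff, Matrix.isUnit_iff_isUnit_det, isUnit_iff_ne_zero, not_not,
    ← Matrix.exists_mulVec_eq_zero_iff]
  refine ⟨x, hx, ?_⟩
  rw [sub_mulVec, h, Algebra.algebraMap_eq_smul_one, smul_mulVec, one_mulVec, sub_self]

theorem spectralRadius_le_ofReal {X : Matrix n n ℂ} {c : ℝ}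
    (h : ∀ l ∈ spectrum ℂ X, ‖l‖ ≤ c) : spectralRadius ℂ X ≤ ENNReal.ofReal c := by
  refine iSup₂_le fun l hl => ?_
  rw [← enorm_eq_nnnorm, ← ofReal_norm]
  exact ENNReal.ofReal_le_ofReal (h l hl)

theorem rho_le {R : Matrix n n ℝ} {c : ℝ} (hc : 0 ≤ c)
    (h : ∀ l ∈ spectrum ℂ (R.map ((↑) : ℝ → ℂ)), ‖l‖ ≤ c) : rho R ≤ c :=
  ENNReal.toReal_le_of_le_ofReal hc (spectralRadius_le_ofReal h)

-- `rho` is defined through `toReal`, which sends `⊤` to `0`; finiteness is what makes `rho` a bound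
-- for the eigenvalues.
open scoped Matrix.Norms.L2Operator in
theorem spectralRadius_lt_top (X : Matrix n n ℂ) : spectralRadius ℂ X < ⊤ := by
  cases isEmpty_or_nonempty n
  · refine (iSup₂_le fun l hl => ?_ : spectralRadius ℂ X ≤ 0).trans_lt ENNReal.zero_lt_top
    obtain ⟨x, hx, -⟩ := exists_mulVec_eq_smul_of_mem_spectrum hl
    exact absurd (Subsingleton.elim x 0) hx
  · exact (spectrum.spectralRadius_le_nnnorm X).trans_lt ENNReal.coe_lt_top

theorem norm_le_rho {R : Matrix n n ℝ} {l : ℂ}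
    (hl : l ∈ spectrum ℂ (R.map ((↑) : ℝ → ℂ))) : ‖l‖ ≤ rho R := by
  have h : (‖l‖₊ : ENNReal) ≤ spectralRadius ℂ (R.map ((↑) : ℝ → ℂ)) :=
    le_iSup₂ (f := fun k (_ : k ∈ spectrum ℂ (R.map ((↑) : ℝ → ℂ))) => (‖k‖₊ : ENNReal)) l hl
  have := ENNReal.toReal_mono (spectralRadius_lt_top _).ne h
  exact this

theorem rho_nonneg (R : Matrix n n ℝ) : 0 ≤ rho R := ENNReal.toReal_nonneg

theorem map_one_sub {k : Type} [DecidableEq k] (R : Matrix k k ℝ) :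
    (1 - R).map ((↑) : ℝ → ℂ) = 1 - R.map ((↑) : ℝ → ℂ) := by
  ext i j
  by_cases h : i = j <;> simp [h]

theorem one_sub_mem_spectrum {R : Matrix n n ℝ} {l : ℂ}
    (hl : l ∈ spectrum ℂ (R.map ((↑) : ℝ → ℂ))) :
    1 - l ∈ spectrum ℂ ((1 - R).map ((↑) : ℝ → ℂ)) := by
  obtain ⟨x, hx, h⟩ := exists_mulVec_eq_smul_of_mem_spectrum hl
  refine mem_spectrum_of_mulVec_eq_smul hx ?_
  rw [map_one_sub, sub_mulVec, h, one_mulVec, sub_smul, one_smul]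

theorem rho_le_one_add (R : Matrix n n ℝ) : rho R ≤ 1 + rho (1 - R) := by
  refine rho_le (by linarith [rho_nonneg (1 - R)]) fun l hl => ?_
  have := norm_le_rho (one_sub_mem_spectrum hl)
  have h2 : ‖l‖ ≤ ‖(1 : ℂ)‖ + ‖1 - l‖ := by
    simpa using norm_sub_le (1 : ℂ) (1 - l)
  rw [norm_one] at h2
  linarith

/-- An eigenvalue must exist: for the empty matrix both spectral radii are `0` and the inequality
fails. -/
theorem one_sub_rho_le [Nonempty n] (R : Matrix n n ℝ) : 1 - rho (1 - R) ≤ rho R := by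
  obtain ⟨l, hl⟩ := spectrum.nonempty_of_isAlgClosed_of_finiteDimensional ℂ
    (R.map ((↑) : ℝ → ℂ))
  have h1 := norm_le_rho (one_sub_mem_spectrum hl)
  have h2 := norm_le_rho hl
  have h3 : ‖(1 : ℂ)‖ ≤ ‖l‖ + ‖1 - l‖ := by
    simpa using norm_add_le l (1 - l)
  rw [norm_one] at h3
  linarith

theorem rho_conj {R P : Matrix n n ℝ} (hP : IsUnit P.det) : rho (P * R * P⁻¹) = rho R := by
  have hu : IsUnit (P.map ((↑) : ℝ → ℂ)) := by
    have := ((Matrix.isUnit_iff_isUnit_det P).2 hP).map (Complex.ofRealHom.mapMatrix (m := n))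
    exact this
  obtain ⟨u, hu⟩ := hu
  have hmul : ∀ X Y : Matrix n n ℝ, (X * Y).map ((↑) : ℝ → ℂ) =
      X.map ((↑) : ℝ → ℂ) * Y.map ((↑) : ℝ → ℂ) := fun X Y =>
    map_mul (Complex.ofRealHom.mapMatrix (m := n)) X Y
  have hinv : (P⁻¹).map ((↑) : ℝ → ℂ) = ↑u⁻¹ := by
    refine Units.eq_inv_of_mul_eq_one_left ?_
    rw [hu, ← hmul, Matrix.mul_nonsing_inv _ hP]
    exact map_one (Complex.ofRealHom.mapMatrix (m := n))
  unfold rho spectralRadius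
  rw [hmul, hmul, ← hu, hinv, spectrum.units_conjugate]

end SpectralRadius

/-! ### GMRes residuals against Richardson iteration -/

section Krylov

variable {n : Type} [Fintype n] [DecidableEq n]

/-- The witness is the Richardson iterate `y ↦ y + (r - R y)`, which multiplies the residual by `1 -
R` and enlarges the Krylov space by one dimension at most. -/
theorem exists_krylov_residual (R : Matrix n n ℝ) (r : n → ℝ) (k : ℕ) :
    ∃ y ∈ krylov R r k, r - R *ᵥ y = ((1 - R) ^ k) *ᵥ r := by
  induction k with
  | zero => exact ⟨0, Submodule.zero_mem _, by simp⟩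
  | succ k ih =>
    obtain ⟨y, hy, h⟩ := ih
    have hr : r ∈ krylov R r (k + 1) := Submodule.subset_span ⟨0, by simp⟩
    have hy1 : y ∈ krylov R r (k + 1) := by
      refine Submodule.span_mono ?_ hy
      rintro _ ⟨i, rfl⟩
      exact ⟨i.castSucc, rfl⟩
    have hRy : R *ᵥ y ∈ krylov R r (k + 1) := by
      have hle : krylov R r k ≤ (krylov R r (k + 1)).comap (Matrix.mulVecLin R) := by
        refine Submodule.span_le.2 ?_
        rintro _ ⟨i, rfl⟩
        refine Submodule.subset_span ⟨i.succ, ?_⟩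
        simp [pow_succ', mulVec_mulVec]
      exact hle hy
    refine ⟨y + (r - R *ᵥ y), Submodule.add_mem _ hy1 (Submodule.sub_mem _ hr hRy), ?_⟩
    rw [pow_succ', ← mulVec_mulVec, ← h, sub_mulVec, one_mulVec, mulVec_add]
    abel

theorem IsGMRes.residual_le {R : Matrix n n ℝ} {f : n → ℝ} {v : ℕ → n → ℝ}
    (hv : IsGMRes R f v) (k : ℕ) :
    euclNorm (f - R *ᵥ v k) ≤ euclNorm (((1 - R) ^ k) *ᵥ (f - R *ᵥ v 0)) := by
  obtain ⟨y, hy, h⟩ := exists_krylov_residual R (f - R *ᵥ v 0) k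
  have := (hv k).2 (v 0 + y) (by simpa using hy)
  rwa [mulVec_add, ← sub_sub, h] at this

theorem euclNorm_eq_complex {k : Type} [Fintype k] (x : k → ℝ) :
    euclNorm x = ‖(WithLp.toLp 2 (fun i => (x i : ℂ)) : EuclideanSpace ℂ k)‖ := by
  simp [euclNorm, EuclideanSpace.norm_eq]

theorem map_pow_complex (R : Matrix n n ℝ) (k : ℕ) :
    (R ^ k).map ((↑) : ℝ → ℂ) = R.map ((↑) : ℝ → ℂ) ^ k :=
  map_pow (Complex.ofRealHom.mapMatrix (m := n)) R k

open scoped Matrix.Norms.L2Operator in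
theorem euclNorm_pow_mulVec_le (R : Matrix n n ℝ) (k : ℕ) (x : n → ℝ) :
    euclNorm ((R ^ k) *ᵥ x) ≤ ‖R.map ((↑) : ℝ → ℂ) ^ k‖ * euclNorm x := by
  rw [euclNorm_eq_complex, euclNorm_eq_complex x, ← map_pow_complex]
  refine le_trans (le_of_eq ?_) (Matrix.l2_opNorm_mulVec _ _)
  congr 1
  ext i
  simp [mulVec, dotProduct]

-- Gelfand's formula: the `k`-th roots of the norms of the powers tend to the spectral radius.
open scoped Matrix.Norms.L2Operator in
theorem asymptoticRate_le_of_residual_le {X : Matrix n n ℝ} {r : ℕ → ℝ} (hr : ∀ k, 0 ≤ r k)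
    (h : ∀ k, r k ≤ ‖X.map ((↑) : ℝ → ℂ) ^ k‖ * r 0) :
    asymptoticRate r ≤ ENNReal.ofReal (rho X) := by
  have hlim := spectrum.pow_nnnorm_pow_one_div_tendsto_nhds_spectralRadius
    (X.map ((↑) : ℝ → ℂ))
  rw [rho, ENNReal.ofReal_toReal (spectralRadius_lt_top _).ne, ← hlim.limsup_eq]
  refine Filter.limsup_le_limsup ?_
  filter_upwards [Filter.eventually_gt_atTop 0] with k hk
  have hk' : (0 : ℝ) < 1 / (k : ℝ) := by positivity
  rcases (hr 0).eq_or_lt with h0 | h0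
  -- For `r 0 = 0` the quotient is `0` by the convention for division, and so is its root because
  -- the exponent is positive.
  · rw [← h0, div_zero, Real.zero_rpow hk'.ne']
    simp
  · have h1 : r k / r 0 ≤ ‖X.map ((↑) : ℝ → ℂ) ^ k‖ := (div_le_iff₀ h0).2 (h k)
    rw [← ENNReal.ofReal_rpow_of_nonneg (div_nonneg (hr k) (hr 0)) hk'.le, ← enorm_eq_nnnorm,
      ← ofReal_norm]
    exact ENNReal.rpow_le_rpow (ENNReal.ofReal_le_ofReal h1) hk'.le

end Krylov

/-! ### Powers of a matrix through its scaled Jordan form -/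

section Jordan

variable {n : Type} [Fintype n] [DecidableEq n]

open scoped Matrix.Norms.L2Operator

theorem condNumber_eq (V : Matrix n n ℂ) : condNumber V = ‖V‖ * ‖V⁻¹‖ := rfl

theorem one_le_condNumber [Nonempty n] {V : Matrix n n ℂ} (hV : IsUnit V.det) :
    1 ≤ condNumber V := by
  rw [condNumber_eq]
  have h := norm_mul_le V V⁻¹
  rw [Matrix.mul_nonsing_inv _ hV] at h
  have h1 : ‖(1 : Matrix n n ℂ)‖ = 1 := norm_one
  rwa [h1] at h

/-- A matrix whose only nonzero entries are ones, on the graph of a partial injection, has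
spectral norm at most one. -/
theorem l2_opNorm_partialInjection_le {P : n → n → Prop} [DecidableRel P]
    (hr : ∀ x y z, P x y → P x z → y = z) (hl : ∀ x y z, P x z → P y z → x = y) :
    ‖(Matrix.of fun x y => if P x y then (1 : ℂ) else 0 : Matrix n n ℂ)‖ ≤ 1 := by
  rw [Matrix.l2_opNorm_def]
  refine ContinuousLinearMap.opNorm_le_bound _ zero_le_one fun u => ?_
  rw [one_mul, EuclideanSpace.norm_eq, EuclideanSpace.norm_eq]
  refine Real.sqrt_le_sqrt ?_
  have key : ∀ x, ‖∑ y, (if P x y then (1 : ℂ) else 0) * u y‖ ^ 2 ≤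
      ∑ y, if P x y then ‖u y‖ ^ 2 else 0 := by
    intro x
    by_cases h : ∃ y, P x y
    · obtain ⟨y, hy⟩ := h
      have : ∀ z, P x z ↔ z = y := fun z => ⟨fun hz => hr x z y hz hy, fun hz => hz ▸ hy⟩
      simp [this]
    · push Not at h
      simp [h]
  refine le_trans (Finset.sum_le_sum fun x _ => ?_) (b := ∑ x, ∑ y, if P x y then ‖u y‖ ^ 2 else 0) ?_
  · exact key x
  · rw [Finset.sum_comm]
    refine Finset.sum_le_sum fun y _ => ?_
    by_cases h : ∃ x, P x y
    · obtain ⟨x, hx⟩ := h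
      have : ∀ z, P z y ↔ z = x := fun z => ⟨fun hz => hl z x y hz hx, fun hz => hz ▸ hx⟩
      simp [this]
    · push Not at h
      simp only [h, if_false, Finset.sum_const_zero]
      positivity

namespace JordanTransform

variable {R : Matrix n n ℝ} (J : JordanTransform R)

theorem conj_apply (x y : n) :
    (J.V⁻¹ * R.map ((↑) : ℝ → ℂ) * J.V) x y =
      if x = y then J.eig (J.e.symm x).1
      else if (J.e.symm x).1 = (J.e.symm y).1 ∧
        ((J.e.symm x).2 : ℕ) + 1 = ((J.e.symm y).2 : ℕ) then 1 else 0 := by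
  rw [J.conj_eq, Matrix.reindex_apply, Matrix.submatrix_apply]
  by_cases hxy : x = y
  · subst hxy
    rw [if_pos rfl, Matrix.blockDiagonal'_apply_eq]
    simp [jordanBlock]
  · rw [if_neg hxy]
    have hxy' : J.e.symm x ≠ J.e.symm y := fun h => hxy (J.e.symm.injective h)
    generalize J.e.symm x = s at *
    generalize J.e.symm y = t at *
    obtain ⟨i, s⟩ := s
    obtain ⟨j, t⟩ := t
    by_cases hij : i = j
    · subst hij
      have : s ≠ t := fun h => hxy' (by rw [h])
      simp [Matrix.blockDiagonal'_apply_eq, jordanBlock, this]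
    · simp [Matrix.blockDiagonal'_apply_ne _ _ _ hij, hij]

/-- The basis vector at position `0` of a block has no superdiagonal entry in its column, so `V`
maps it to an eigenvector. -/
theorem eig_mem_spectrum (i : Fin J.p) :
    J.eig i ∈ spectrum ℂ (R.map ((↑) : ℝ → ℂ)) := by
  obtain ⟨x0, hx0⟩ := J.e.symm.surjective ⟨i, ⟨0, J.size_pos i⟩⟩
  have hV : IsUnit J.V := (Matrix.isUnit_iff_isUnit_det _).2 J.isUnit_det
  refine mem_spectrum_of_mulVec_eq_smul (x := J.V *ᵥ Pi.single x0 1) (fun h => ?_) ?_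
  · have h1 : J.V⁻¹ *ᵥ (J.V *ᵥ Pi.single x0 (1 : ℂ)) = 0 := by rw [h, mulVec_zero]
    rw [mulVec_mulVec, Matrix.nonsing_inv_mul _ J.isUnit_det, one_mulVec] at h1
    simpa using congrFun h1 x0
  · have h1 : (J.V⁻¹ * R.map ((↑) : ℝ → ℂ) * J.V) *ᵥ Pi.single x0 1
        = J.eig i • Pi.single x0 (1 : ℂ) := by
      ext y
      rw [mulVec_single_one, Matrix.col_apply, J.conj_apply]
      have h0 : ((J.e.symm x0).2 : ℕ) = 0 := by rw [hx0]
      by_cases hy : y = x0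
      · subst hy
        simp [hx0]
      · simp [hy, h0]
    have h2 := congrArg (J.V *ᵥ ·) h1
    simp only [mulVec_mulVec, ← Matrix.mul_assoc, mulVec_smul] at h2
    rw [Matrix.mul_nonsing_inv _ J.isUnit_det, Matrix.one_mul, ← mulVec_mulVec] at h2
    exact h2

/-- The position of a basis vector in its Jordan block. -/
def pos (x : n) : ℕ := ((J.e.symm x).2 : ℕ)

theorem pos_lt_m (x : n) : J.pos x < J.m :=
  lt_of_lt_of_le (J.e.symm x).2.2 (Finset.le_sup (f := J.size) (Finset.mem_univ _))

/-- Powers of `1 - R` in the spectral norm, by a diagonal scaling of the Jordan form. -/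
theorem norm_one_sub_pow_le {q δ : ℝ} (hδ : 0 < δ) (hδ1 : δ ≤ 1)
    (hq : rho (1 - R) ≤ q) (k : ℕ) :
    ‖(1 - R).map ((↑) : ℝ → ℂ) ^ k‖ ≤
      condNumber J.V * (δ⁻¹) ^ (J.m - 1) * (q + δ) ^ k := by
  have hq0 : 0 ≤ q := (rho_nonneg _).trans hq
  have hδC : (δ : ℂ) ≠ 0 := by exact_mod_cast hδ.ne'
  set P : n → n → Prop := fun x y => (J.e.symm x).1 = (J.e.symm y).1 ∧
    ((J.e.symm x).2 : ℕ) + 1 = ((J.e.symm y).2 : ℕ) with hP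
  set N : Matrix n n ℂ := Matrix.of fun x y => if P x y then (1 : ℂ) else 0 with hN
  set Lam : Matrix n n ℂ := diagonal fun x => 1 - J.eig (J.e.symm x).1 with hLam
  set S : Matrix n n ℂ := diagonal fun x => (δ : ℂ) ^ J.pos x with hS
  set S' : Matrix n n ℂ := diagonal fun x => ((δ : ℂ)⁻¹) ^ J.pos x with hS'
  set Y : Matrix n n ℂ := Lam - (δ : ℂ) • N with hY
  have hSS : S' * S = 1 := by
    rw [hS, hS', diagonal_mul_diagonal, ← diagonal_one]
    congr 1
    funext x
    rw [← mul_pow, inv_mul_cancel₀ hδC, one_pow]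
  -- Conjugation by the powers of `δ` multiplies a superdiagonal entry by `δ^pos x · δ^(-(pos x +
  -- 1)) = δ⁻¹`, so `-δ` in `Y` corresponds to `-1` in the Jordan form.
  have hX : 1 - J.V⁻¹ * R.map ((↑) : ℝ → ℂ) * J.V = S * Y * S' := by
    ext x y
    rw [hS, hS', mul_diagonal, diagonal_mul, Matrix.sub_apply, J.conj_apply, hY, hLam, hN,
      Matrix.sub_apply, Matrix.smul_apply, Matrix.of_apply]
    by_cases hxy : x = y
    · subst hxy
      have : ¬ P x x := fun h => absurd h.2 (by omega)
      rw [if_neg this, if_pos rfl, Matrix.one_apply_eq, diagonal_apply_eq, smul_zero, sub_zero,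
        mul_right_comm, ← mul_pow, mul_inv_cancel₀ hδC, one_pow, one_mul]
    · rw [if_neg hxy, Matrix.one_apply_ne hxy, diagonal_apply_ne _ hxy]
      change 0 - (if P x y then (1 : ℂ) else 0) = _
      by_cases h : P x y
      · have : J.pos y = J.pos x + 1 := h.2.symm
        rw [if_pos h, this, pow_succ, inv_pow, smul_eq_mul]
        field_simp
        ring
      · rw [if_neg h]
        simp
  have hpow : (1 - R).map ((↑) : ℝ → ℂ) ^ k = J.V * S * Y ^ k * (S' * J.V⁻¹) := by
    have hbase : (1 - R).map ((↑) : ℝ → ℂ) = J.V * S * Y * (S' * J.V⁻¹) := by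
      calc (1 - R).map ((↑) : ℝ → ℂ)
          = (J.V * J.V⁻¹) * (1 - R.map ((↑) : ℝ → ℂ)) * (J.V * J.V⁻¹) := by
            rw [Matrix.mul_nonsing_inv _ J.isUnit_det, one_mul, mul_one, map_one_sub]
        _ = J.V * (J.V⁻¹ * J.V - J.V⁻¹ * R.map ((↑) : ℝ → ℂ) * J.V) * J.V⁻¹ := by noncomm_ring
        _ = _ := by
            rw [Matrix.nonsing_inv_mul _ J.isUnit_det, hX]
            simp only [Matrix.mul_assoc]
    have hmid : S' * J.V⁻¹ * (J.V * S) = 1 := by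
      rw [Matrix.mul_assoc, ← Matrix.mul_assoc J.V⁻¹, Matrix.nonsing_inv_mul _ J.isUnit_det,
        Matrix.one_mul, hSS]
    induction k with
    | zero =>
      rw [pow_zero, pow_zero, mul_one]
      exact (mul_eq_one_comm.1 hmid).symm
    | succ k ih =>
      rw [pow_succ, ih, hbase, pow_succ]
      calc J.V * S * Y ^ k * (S' * J.V⁻¹) * (J.V * S * Y * (S' * J.V⁻¹))
          = J.V * S * Y ^ k * (S' * J.V⁻¹ * (J.V * S)) * Y * (S' * J.V⁻¹) := by
            simp only [Matrix.mul_assoc]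
        _ = _ := by rw [hmid, mul_one]; simp only [Matrix.mul_assoc]
  have hNn : ‖N‖ ≤ 1 := by
    refine l2_opNorm_partialInjection_le ?_ ?_
    · rintro x y z ⟨h1, h2⟩ ⟨h3, h4⟩
      refine J.e.symm.injective (Sigma.ext (h1.symm.trans h3) ?_)
      exact (Fin.heq_ext_iff (by rw [h1.symm.trans h3])).2 (by omega)
    · rintro x y z ⟨h1, h2⟩ ⟨h3, h4⟩
      refine J.e.symm.injective (Sigma.ext (h1.trans h3.symm) ?_)
      exact (Fin.heq_ext_iff (by rw [h1.trans h3.symm])).2 (by omega)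
  have hLn : ‖Lam‖ ≤ q := by
    rw [hLam, l2_opNorm_diagonal]
    refine (pi_norm_le_iff_of_nonneg hq0).2 fun x => ?_
    exact (norm_le_rho (one_sub_mem_spectrum (J.eig_mem_spectrum _))).trans hq
  have hYn : ‖Y‖ ≤ q + δ := by
    refine (norm_sub_le _ _).trans (add_le_add hLn ?_)
    rw [norm_smul, Complex.norm_real, Real.norm_of_nonneg hδ.le]
    exact mul_le_of_le_one_right hδ.le hNn
  have hSn : ‖S‖ ≤ 1 := by
    rw [hS, l2_opNorm_diagonal]
    refine (pi_norm_le_iff_of_nonneg zero_le_one).2 fun x => ?_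
    rw [norm_pow, Complex.norm_real, Real.norm_of_nonneg hδ.le]
    exact pow_le_one₀ hδ.le hδ1
  -- Positions in a block start at `0`, so the largest exponent is `m - 1`.
  have hSn' : ‖S'‖ ≤ (δ⁻¹) ^ (J.m - 1) := by
    rw [hS', l2_opNorm_diagonal]
    refine (pi_norm_le_iff_of_nonneg (by positivity)).2 fun x => ?_
    rw [norm_pow, norm_inv, Complex.norm_real, Real.norm_of_nonneg hδ.le]
    exact pow_le_pow_right₀ ((one_le_inv₀ hδ).2 hδ1) (by have := J.pos_lt_m x; omega)
  have hYk : ‖Y ^ k‖ ≤ (q + δ) ^ k := by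
    cases isEmpty_or_nonempty n
    · rw [Subsingleton.elim (Y ^ k) 0, norm_zero]
      positivity
    · exact (norm_pow_le _ _).trans (pow_le_pow_left₀ (norm_nonneg _) hYn k)
  rw [hpow, condNumber_eq]
  calc ‖J.V * S * Y ^ k * (S' * J.V⁻¹)‖
      ≤ ‖J.V‖ * ‖S‖ * ‖Y ^ k‖ * (‖S'‖ * ‖J.V⁻¹‖) := by
        refine (norm_mul_le _ _).trans (mul_le_mul ?_ (norm_mul_le _ _) (norm_nonneg _)
          (by positivity))
        exact (norm_mul_le _ _).trans (mul_le_mul_of_nonneg_right (norm_mul_le _ _)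
          (norm_nonneg _))
    _ ≤ ‖J.V‖ * 1 * (q + δ) ^ k * ((δ⁻¹) ^ (J.m - 1) * ‖J.V⁻¹‖) := by gcongr
    _ = _ := by ring

theorem one_le_m [Nonempty n] : 1 ≤ J.m :=
  Nat.one_le_of_lt (J.pos_lt_m (Classical.arbitrary n))

end JordanTransform

end Jordan

/-! ### Barycentric coordinates and the nodal basis -/

theorem IsBarycentric.mono {d : ℕ} {s t : Finset (Space d)} (hst : s ⊆ t) {w : Space d → ℝ}
    {x : Space d} (h : IsBarycentric s w x) : IsBarycentric t w x := by
  obtain ⟨h1, h2, h3, h4⟩ := h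
  refine ⟨fun y _ => ?_, fun y hy => h2 y fun hs => hy (hst hs), ?_, ?_⟩
  · by_cases hy : y ∈ s
    · exact h1 y hy
    · exact (h2 y hy).ge
  · rw [← h3]
    exact (Finset.sum_subset hst fun y _ hy => h2 y hy).symm
  · rw [← h4]
    exact (Finset.sum_subset hst fun y _ hy => by rw [h2 y hy, zero_smul]).symm

theorem IsBarycentric.unique {d : ℕ} {s : Finset (Space d)}
    (hs : AffineIndependent ℝ ((↑) : s → Space d)) {w w' : Space d → ℝ} {x : Space d}
    (h : IsBarycentric s w x) (h' : IsBarycentric s w' x) : w = w' := by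
  funext y
  by_cases hy : y ∈ s
  · exact hs.eq_of_sum_eq_sum_subtype (h.2.2.1.trans h'.2.2.1.symm)
      (h.2.2.2.trans h'.2.2.2.symm) y hy
  · rw [h.2.1 y hy, h'.2.1 y hy]

theorem IsBarycentric.mem_convexHull {d : ℕ} {s : Finset (Space d)} {w : Space d → ℝ}
    {x : Space d} (h : IsBarycentric s w x) : x ∈ convexHull ℝ (s : Set (Space d)) :=
  Finset.mem_convexHull'.2 ⟨w, h.1, h.2.2.1, h.2.2.2⟩

theorem exists_isBarycentric {d : ℕ} {s : Finset (Space d)} {x : Space d}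
    (hx : x ∈ convexHull ℝ (s : Set (Space d))) : ∃ w, IsBarycentric s w x := by
  classical
  obtain ⟨w, h1, h2, h3⟩ := Finset.mem_convexHull'.1 hx
  refine ⟨fun y => if y ∈ s then w y else 0, fun y hy => ?_, fun y hy => if_neg hy, ?_, ?_⟩
  · simpa [hy] using h1 y hy
  · rw [← h2]
    exact Finset.sum_congr rfl fun y hy => if_pos hy
  · rw [← h3]
    exact Finset.sum_congr rfl fun y hy => by simp [hy]

namespace Triangulation

variable {d : ℕ} {Ω : Set (Space d)} (T : Triangulation Ω)

/-- Two simplices meet in the hull of their common vertices, and coordinates with respect to that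
face, extended by zero, are coordinates for both. -/
theorem isBarycentric_unique {s t : Finset (Space d)} (hs : s ∈ T.complex.faces)
    (ht : t ∈ T.complex.faces) {w w' : Space d → ℝ} {x : Space d}
    (h : IsBarycentric s w x) (h' : IsBarycentric t w' x) : w = w' := by
  classical
  have hx : x ∈ convexHull ℝ (((s ∩ t : Finset (Space d))) : Set (Space d)) := by
    rw [Finset.coe_inter]
    exact T.complex.inter_subset_convexHull hs ht ⟨h.mem_convexHull, h'.mem_convexHull⟩
  obtain ⟨w'', hw⟩ := exists_isBarycentric hx
  rw [h.unique (T.complex.indep hs) (IsBarycentric.mono Finset.inter_subset_left hw),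
    h'.unique (T.complex.indep ht) (IsBarycentric.mono Finset.inter_subset_right hw)]

theorem isBarycentric_barycentric {s : Finset (Space d)} (hs : s ∈ T.complex.faces)
    {x : Space d} (hx : x ∈ convexHull ℝ (s : Set (Space d))) :
    IsBarycentric s (T.barycentric x) x := by
  obtain ⟨w, hw⟩ := exists_isBarycentric hx
  have hex : ∃ w : Space d → ℝ, ∃ s ∈ T.complex.faces, IsBarycentric s w x := ⟨w, s, hs, hw⟩
  have hb : T.barycentric x = hex.choose := dif_pos hex
  obtain ⟨t, ht, hwt⟩ := hex.choose_spec
  rw [hb, ← T.isBarycentric_unique hs ht hw hwt]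
  exact hw

theorem barycentric_eq_zero {x : Space d} (hx : x ∉ T.complex.space) : T.barycentric x = 0 := by
  refine dif_neg ?_
  rintro ⟨w, s, hs, hw⟩
  exact hx (T.complex.mem_space_iff.2 ⟨s, hs, hw.mem_convexHull⟩)

theorem hat_nonneg (z : T.Node) (x : Space d) : 0 ≤ T.hat z x := by
  by_cases hx : x ∈ T.complex.space
  · obtain ⟨s, hs, hxs⟩ := T.complex.mem_space_iff.1 hx
    have h := T.isBarycentric_barycentric hs hxs
    by_cases hz : z.1 ∈ s
    · exact h.1 _ hz
    · exact (h.2.1 _ hz).ge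
  · rw [hat, T.barycentric_eq_zero hx, Pi.zero_apply]

theorem sum_hat_le_one (x : Space d) : ∑ z, T.hat z x ≤ 1 := by
  classical
  by_cases hx : x ∈ T.complex.space
  · obtain ⟨s, hs, hxs⟩ := T.complex.mem_space_iff.1 hx
    obtain ⟨h1, h2, h3, -⟩ := T.isBarycentric_barycentric hs hxs
    rw [← h3]
    have hinj : Set.InjOn (fun z : T.Node => z.1) (Finset.univ : Finset T.Node) :=
      fun z _ z' _ h => Subtype.ext h
    calc ∑ z, T.hat z x = ∑ y ∈ Finset.univ.image (fun z : T.Node => z.1), T.barycentric x y :=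
          (Finset.sum_image hinj).symm
      _ = ∑ y ∈ Finset.univ.image (fun z : T.Node => z.1) with y ∈ s, T.barycentric x y := by
          rw [Finset.sum_filter_of_ne]
          intro y _ hy
          by_contra hys
          exact hy (h2 y hys)
      _ ≤ ∑ y ∈ s, T.barycentric x y :=
          Finset.sum_le_sum_of_subset_of_nonneg (fun y hy => (Finset.mem_filter.1 hy).2)
            fun y hy _ => h1 y hy
  · simp [hat, T.barycentric_eq_zero hx]

theorem hat_le_one (z : T.Node) (x : Space d) : T.hat z x ≤ 1 :=
  (Finset.single_le_sum (fun z _ => T.hat_nonneg z x) (Finset.mem_univ z)).trans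
    (T.sum_hat_le_one x)

theorem hat_eq_zero_of_not_mem {s : Finset (Space d)} (hs : s ∈ T.complex.faces) {x : Space d}
    (hx : x ∈ convexHull ℝ (s : Set (Space d))) {z : T.Node} (hz : z.1 ∉ s) : T.hat z x = 0 :=
  (T.isBarycentric_barycentric hs hx).2.1 _ hz

theorem hat_node (z z' : T.Node) : T.hat z z'.1 = if z = z' then 1 else 0 := by
  have hs : ({z'.1} : Finset (Space d)) ∈ T.complex.faces := z'.2.1
  have h := T.isBarycentric_barycentric hs (x := z'.1) (by simp)
  by_cases hz : z = z'
  · subst hz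
    simpa [hat] using h.2.2.1
  · rw [if_neg hz]
    exact h.2.1 _ (by simpa using fun h' => hz (Subtype.ext h'))

/-- A boundary point lies in a simplex contained in the boundary, none of whose vertices is in the
open set `Ω`. -/
theorem hat_eq_zero_of_not_mem_domain (hΩ : IsOpen Ω) (z : T.Node) {x : Space d} (hx : x ∉ Ω) :
    T.hat z x = 0 := by
  by_cases hxc : x ∈ T.complex.space
  · have hf : x ∈ frontier Ω := by
      rw [hΩ.frontier_eq]
      exact ⟨T.space_eq ▸ hxc, hx⟩
    obtain ⟨s, hs, hxs, hsub⟩ := T.frontier_resolved x hf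
    refine T.hat_eq_zero_of_not_mem hs hxs fun hz => ?_
    have h1 := hsub (subset_convexHull ℝ _ (Finset.mem_coe.2 hz))
    rw [hΩ.frontier_eq] at h1
    exact h1.2 z.2.2
  · rw [hat, T.barycentric_eq_zero hxc, Pi.zero_apply]

/-- On a simplex of full dimension the nodal basis functions are affine. -/
theorem exists_affine_eqOn_hat {t : Finset (Space d)} (ht : t ∈ T.complex.faces)
    (hcard : t.card = d + 1) (z : T.Node) :
    ∃ g : Space d →ᵃ[ℝ] ℝ, Set.EqOn (T.hat z) g (convexHull ℝ (t : Set (Space d))) := by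
  by_cases hz : z.1 ∈ t
  · have hind := T.complex.indep ht
    have htop : affineSpan ℝ (Set.range ((↑) : t → Space d)) = ⊤ := by
      rw [hind.affineSpan_eq_top_iff_card_eq_finrank_add_one]
      simp [hcard]
    let b : AffineBasis t ℝ (Space d) := ⟨_, hind, htop⟩
    refine ⟨b.coord ⟨z.1, hz⟩, fun x hx => ?_⟩
    obtain ⟨h1, h2, h3, h4⟩ := T.isBarycentric_barycentric ht hx
    have h3' : ∑ y : t, T.barycentric x y = 1 := by rw [Finset.sum_coe_sort t, h3]
    have hcomb : (Finset.univ : Finset t).affineCombination ℝ b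
        (fun y => T.barycentric x y) = x := by
      rw [Finset.affineCombination_eq_linear_combination _ _ _ h3']
      exact (Finset.sum_coe_sort t fun y => T.barycentric x y • y).trans h4
    have hco := b.coord_apply_combination_of_mem (Finset.mem_univ ⟨z.1, hz⟩) h3'
    rw [hcomb] at hco
    exact hco.symm
  · exact ⟨0, fun x hx => T.hat_eq_zero_of_not_mem ht hx hz⟩

theorem exists_affine_eqOn_sum_hat {t : Finset (Space d)} (ht : t ∈ T.complex.faces)
    (hcard : t.card = d + 1) (v : T.Node → ℝ) :
    ∃ g : Space d →ᵃ[ℝ] ℝ,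
      Set.EqOn (fun x => ∑ z, v z * T.hat z x) g (convexHull ℝ (t : Set (Space d))) := by
  choose g hg using T.exists_affine_eqOn_hat ht hcard
  refine ⟨∑ z, v z • g z, fun x hx => ?_⟩
  have : ∀ S : Finset T.Node, (∑ z ∈ S, v z • g z) x = ∑ z ∈ S, v z * g z x := by
    intro S
    induction S using Finset.induction_on with
    | empty => simp
    | insert z S hz ih => simp [Finset.sum_insert hz, ih]
  rw [this]
  exact Finset.sum_congr rfl fun z _ => by rw [hg z hx]

theorem exists_full_simplex {x : Space d} (hx : x ∈ closure Ω) :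
    ∃ t ∈ T.complex.faces, t.card = d + 1 ∧ x ∈ convexHull ℝ (t : Set (Space d)) := by
  rw [← T.space_eq] at hx
  obtain ⟨s, hs, hxs⟩ := T.complex.mem_space_iff.1 hx
  obtain ⟨t, ht, hst, hc⟩ := T.pure_dim s hs
  exact ⟨t, ht, hc, convexHull_mono (Finset.coe_subset.2 hst) hxs⟩

/-- Gluing over a finite closed cover: the complement of `Ω`, where the function vanishes, and the
full simplices, where it is affine. -/
theorem continuous_hat (hΩ : IsOpen Ω) (z : T.Node) : Continuous (T.hat z) := by
  have := T.finite_faces.to_subtype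
  let F : Option {t // t ∈ T.complex.faces ∧ t.card = d + 1} → Set (Space d) := fun o =>
    o.elim Ωᶜ fun t => convexHull ℝ (t.1 : Set (Space d))
  have : Finite {t // t ∈ T.complex.faces ∧ t.card = d + 1} :=
    (T.finite_faces.subset fun t ht => ht.1 :
      {t | t ∈ T.complex.faces ∧ t.card = d + 1}.Finite).to_subtype
  refine LocallyFinite.continuous (f := F) (locallyFinite_of_finite F) ?_ ?_ ?_
  · refine Set.eq_univ_of_forall fun x => Set.mem_iUnion.2 ?_
    by_cases hx : x ∈ Ω
    · obtain ⟨t, ht, hc, hxt⟩ := T.exists_full_simplex (subset_closure hx)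
      exact ⟨some ⟨t, ht, hc⟩, hxt⟩
    · exact ⟨none, hx⟩
  · rintro (_ | t)
    · exact hΩ.isClosed_compl
    · exact (t.1.finite_toSet.isCompact_convexHull (𝕜 := ℝ)).isClosed
  · rintro (_ | t)
    · exact continuousOn_const.congr fun x hx => T.hat_eq_zero_of_not_mem_domain hΩ z hx
    · obtain ⟨g, hg⟩ := T.exists_affine_eqOn_hat t.2.1 t.2.2 z
      exact (AffineMap.continuous_of_finiteDimensional g).continuousOn.congr hg

theorem hat_mem_feSpace (hΩ : IsOpen Ω) (z : T.Node) : T.hat z ∈ T.feSpace := by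
  refine ⟨T.continuous_hat hΩ z, fun x hx => T.hat_eq_zero_of_not_mem_domain hΩ z hx,
    fun s hs => ?_⟩
  obtain ⟨t, ht, hst, hc⟩ := T.pure_dim s hs
  obtain ⟨g, hg⟩ := T.exists_affine_eqOn_hat ht hc z
  exact ⟨g, hg.mono (convexHull_mono (Finset.coe_subset.2 hst))⟩

/-- A finite element function is determined by its nodal values. -/
theorem eq_zero_of_nodal {u : Space d → ℝ} (hu : u ∈ T.feSpace) (h : ∀ z : T.Node, u z.1 = 0) :
    u = 0 := by
  obtain ⟨-, h0, haff⟩ := hu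
  funext x
  by_cases hx : x ∈ Ω
  · obtain ⟨t, ht, -, hxt⟩ := T.exists_full_simplex (subset_closure hx)
    obtain ⟨g, hg⟩ := haff t ht
    have hsub : (t : Set (Space d)) ⊆ g ⁻¹' {0} := by
      intro y hy
      have hyv : y ∈ T.complex.vertices := by
        refine T.complex.down_closed ht (by simpa using hy) (by simp)
      rw [Set.mem_preimage, ← hg (subset_convexHull ℝ _ hy)]
      by_cases hyΩ : y ∈ Ω
      · exact h ⟨y, hyv, hyΩ⟩
      · exact h0 y hyΩ
    have hconv : Convex ℝ (g ⁻¹' {0}) := (convex_singleton 0).affine_preimage g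
    rw [hg hxt]
    exact convexHull_min hsub hconv hxt
  · exact h0 x hx

theorem finiteDimensional_feSpace : FiniteDimensional ℝ T.feSpace := by
  let ev : T.feSpace →ₗ[ℝ] T.Node → ℝ :=
    { toFun := fun u z => u.1 z.1
      map_add' := fun _ _ => rfl
      map_smul' := fun _ _ => rfl }
  refine Module.Finite.of_injective ev ((injective_iff_map_eq_zero ev).2 fun u hu => ?_)
  exact Subtype.ext (T.eq_zero_of_nodal u.2 fun z => congrFun hu z)

theorem finrank_feSpace_pos (hΩ : IsOpen Ω) [Nonempty T.Node] :
    0 < Module.finrank ℝ T.feSpace := by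
  have := T.finiteDimensional_feSpace
  obtain ⟨z⟩ := ‹Nonempty T.Node›
  refine Module.finrank_pos_iff_exists_ne_zero.2 ⟨⟨T.hat z, T.hat_mem_feSpace hΩ z⟩, fun h => ?_⟩
  have h1 := congrFun (congrArg Subtype.val h) z.1
  change T.hat z z.1 = 0 at h1
  simp [T.hat_node] at h1

theorem diam_le_meshSize {t : Finset (Space d)} (ht : t ∈ T.complex.faces) :
    Metric.diam (convexHull ℝ (t : Set (Space d))) ≤ T.meshSize :=
  le_csSup (T.finite_faces.image _).bddAbove ⟨t, ht, rfl⟩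

end Triangulation

/-! ### Gradients and the stiffness form -/

theorem hasFDerivAt_of_eqOn_affine {d : ℕ} {u : Space d → ℝ} {g : Space d →ᵃ[ℝ] ℝ}
    {s : Set (Space d)} (hg : Set.EqOn u g s) {x : Space d} (hx : x ∈ interior s) :
    HasFDerivAt u g.linear.toContinuousLinearMap x := by
  have h1 : HasFDerivAt (fun y => g.linear.toContinuousLinearMap y + g 0)
      g.linear.toContinuousLinearMap x :=
    g.linear.toContinuousLinearMap.hasFDerivAt.add_const _
  refine h1.congr_of_eventuallyEq ?_
  filter_upwards [mem_interior_iff_mem_nhds.1 hx] with y hy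
  rw [hg hy, g.decomp]
  simp

theorem inner_gradient_of_eqOn_affine {d : ℕ} {u : Space d → ℝ} {g : Space d →ᵃ[ℝ] ℝ}
    {s : Set (Space d)} (hg : Set.EqOn u g s) {x : Space d} (hx : x ∈ interior s)
    (y z : Space d) : inner ℝ (gradient u x) (y - z) = g y - g z := by
  rw [inner_gradient_left, (hasFDerivAt_of_eqOn_affine hg hx).fderiv]
  have := g.linearMap_vsub y z
  simpa using this

theorem measurable_gradient_apply {d : ℕ} (u : Space d → ℝ) (i : Fin d) :
    Measurable fun x => (gradient u x).ofLp i := by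
  have h1 : Measurable (gradient u) :=
    (InnerProductSpace.toDual ℝ (Space d)).symm.continuous.measurable.comp (measurable_fderiv ℝ u)
  have h2 : Continuous fun y : Space d => y.ofLp i := by fun_prop
  exact h2.measurable.comp h1

/-- Polarisation turns the bounds on the quadratic form into bounds on the entries, which make the
stiffness integrands integrable. -/
theorem IsDiffusionCoefficient.exists_entry_bound {d : ℕ} {Ω : Set (Space d)}
    {a : Space d → Matrix (Fin d) (Fin d) ℝ} (ha : IsDiffusionCoefficient Ω a) :
    ∃ K : ℝ, ∀ᵐ x ∂(volume.restrict Ω), ∀ i j, |a x i j| ≤ K := by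
  obtain ⟨lo, hi, hlo, h⟩ := ha.elliptic
  refine ⟨2 * |hi|, ?_⟩
  filter_upwards [h, ha.symm] with x hx hs i j
  have hle := le_abs_self hi
  have hab := abs_nonneg hi
  have hsq : ∀ ξ : Fin d → ℝ, 0 ≤ ξ ⬝ᵥ ξ := fun ξ =>
    Finset.sum_nonneg fun i _ => mul_self_nonneg _
  have hpos : ∀ ξ : Fin d → ℝ, 0 ≤ ξ ⬝ᵥ (a x *ᵥ ξ) := fun ξ =>
    (mul_nonneg hlo.le (hsq ξ)).trans (hx ξ).1
  have hup : ∀ ξ : Fin d → ℝ, ξ ⬝ᵥ (a x *ᵥ ξ) ≤ |hi| * (ξ ⬝ᵥ ξ) := fun ξ =>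
    (hx ξ).2.trans (mul_le_mul_of_nonneg_right hle (hsq ξ))
  have hee : ∀ i j : Fin d, Pi.single i (1 : ℝ) ⬝ᵥ (a x *ᵥ Pi.single j 1) = a x i j := by
    intro i j
    simp
  have hii := hup (Pi.single i 1)
  have hjj := hup (Pi.single j 1)
  have hij := hup (Pi.single i 1 + Pi.single j 1)
  have hij' := hpos (Pi.single i 1 + Pi.single j 1)
  have hi0 := hpos (Pi.single i 1)
  have hj0 := hpos (Pi.single j 1)
  simp only [mulVec_add, dotProduct_add, add_dotProduct, hee, hs.apply i j] at *
  have hss : ∀ i : Fin d, Pi.single i (1 : ℝ) ⬝ᵥ Pi.single i (1 : ℝ) = 1 := by simp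
  have hst : Pi.single i (1 : ℝ) ⬝ᵥ Pi.single j (1 : ℝ) ≤ 1 := by
    by_cases hne : i = j <;> simp [hne]
  have hts : Pi.single j (1 : ℝ) ⬝ᵥ Pi.single i (1 : ℝ) ≤ 1 := by
    rwa [dotProduct_comm]
  rw [hss] at hii hjj
  rw [hss, hss] at hij
  rw [abs_le]
  have h4 : |hi| * (1 + Pi.single i (1 : ℝ) ⬝ᵥ Pi.single j (1 : ℝ)
      + (Pi.single j (1 : ℝ) ⬝ᵥ Pi.single i (1 : ℝ) + 1)) ≤ |hi| * 4 :=
    mul_le_mul_of_nonneg_left (by linarith) hab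
  constructor <;> nlinarith

/-- With the identity coefficient the energy is `∫ |∇u|²`, so its integrability is a special case.
-/
theorem IsDiffusionCoefficient.one {d : ℕ} (Ω : Set (Space d)) :
    IsDiffusionCoefficient Ω (fun _ => 1) where
  aemeasurable i j := aemeasurable_const
  symm := Filter.Eventually.of_forall fun _ => Matrix.isSymm_one
  elliptic := ⟨1, 1, one_pos, Filter.Eventually.of_forall fun _ ξ => by simp⟩

namespace Triangulation

variable {d : ℕ} {Ω : Set (Space d)} (T : Triangulation Ω)

/-- The boundary of a convex set is null and there are finitely many simplices; all pointwise
gradient computations take place on this set of full measure. -/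
theorem ae_mem_interior_simplex : ∀ᵐ x ∂(volume.restrict Ω), ∃ t ∈ T.complex.faces,
    t.card = d + 1 ∧ x ∈ interior (convexHull ℝ (t : Set (Space d))) := by
  have h1 : ∀ᵐ x ∂(volume : Measure (Space d)), ∀ t ∈ T.complex.faces,
      x ∉ frontier (convexHull ℝ (t : Set (Space d))) := by
    rw [ae_ball_iff T.finite_faces.countable]
    exact fun t _ => measure_eq_zero_iff_ae_notMem.1
      ((convex_convexHull ℝ _).addHaar_frontier volume)
  have h2 : ∀ᵐ x ∂(volume.restrict Ω), x ∈ closure Ω :=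
    ae_restrict_of_ae_restrict_of_subset subset_closure
      (ae_restrict_mem isClosed_closure.measurableSet)
  filter_upwards [ae_restrict_of_ae h1, h2] with x hx hxΩ
  obtain ⟨t, ht, hc, hxt⟩ := T.exists_full_simplex hxΩ
  refine ⟨t, ht, hc, ?_⟩
  by_contra hni
  exact hx t ht ⟨subset_closure hxt, hni⟩

/-- The finite element function with nodal values `v`. -/
def interp (v : T.Node → ℝ) (x : Space d) : ℝ := ∑ z, v z * T.hat z x

theorem interp_node (v : T.Node → ℝ) (z : T.Node) : T.interp v z.1 = v z := by
  simp [interp, T.hat_node]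

theorem gradient_interp {t : Finset (Space d)} (ht : t ∈ T.complex.faces)
    (hc : t.card = d + 1) {x : Space d} (hx : x ∈ interior (convexHull ℝ (t : Set (Space d))))
    (v : T.Node → ℝ) : gradient (T.interp v) x = ∑ z, v z • gradient (T.hat z) x := by
  have h1 : ∀ z, HasFDerivAt (T.hat z) (fderiv ℝ (T.hat z) x) x := fun z => by
    obtain ⟨g, hg⟩ := T.exists_affine_eqOn_hat ht hc z
    exact (hasFDerivAt_of_eqOn_affine hg hx).differentiableAt.hasFDerivAt
  have h2 : HasFDerivAt (T.interp v) (∑ z, v z • fderiv ℝ (T.hat z) x) x :=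
    HasFDerivAt.fun_sum fun z _ => (h1 z).const_mul (v z)
  rw [gradient, h2.fderiv, map_sum]
  exact Finset.sum_congr rfl fun z _ => by rw [map_smulₛₗ]; rfl

theorem exists_gradient_bound (z : T.Node) :
    ∃ K : ℝ, ∀ᵐ x ∂(volume.restrict Ω), ∀ i, |(gradient (T.hat z) x).ofLp i| ≤ K := by
  have : Finite {t // t ∈ T.complex.faces ∧ t.card = d + 1} :=
    (T.finite_faces.subset fun t ht => ht.1 :
      {t | t ∈ T.complex.faces ∧ t.card = d + 1}.Finite).to_subtype
  choose g hg using fun t : {t // t ∈ T.complex.faces ∧ t.card = d + 1} =>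
    T.exists_affine_eqOn_hat t.2.1 t.2.2 z
  obtain ⟨K, hK⟩ := (Set.finite_range fun t => ‖(g t).linear.toContinuousLinearMap‖).bddAbove
  refine ⟨K, ?_⟩
  filter_upwards [T.ae_mem_interior_simplex] with x hx i
  obtain ⟨t, ht, hc, hxt⟩ := hx
  have h1 : ‖gradient (T.hat z) x‖ ≤ K := by
    rw [gradient, LinearIsometryEquiv.norm_map,
      (hasFDerivAt_of_eqOn_affine (hg ⟨t, ht, hc⟩) hxt).fderiv]
    exact hK ⟨⟨t, ht, hc⟩, rfl⟩
  exact (PiLp.norm_apply_le (gradient (T.hat z) x) i).trans h1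

theorem integrable_stiffness (hΩ : Bornology.IsBounded Ω)
    {a : Space d → Matrix (Fin d) (Fin d) ℝ} (ha : IsDiffusionCoefficient Ω a) (z z' : T.Node) :
    Integrable (fun x => (a x *ᵥ (gradient (T.hat z) x).ofLp) ⬝ᵥ (gradient (T.hat z') x).ofLp)
      (volume.restrict Ω) := by
  have hfin : IsFiniteMeasure (volume.restrict Ω) :=
    ⟨by rw [Measure.restrict_apply_univ]; exact hΩ.measure_lt_top⟩
  obtain ⟨K, hK⟩ := ha.exists_entry_bound
  obtain ⟨L, hL⟩ := T.exists_gradient_bound z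
  obtain ⟨L', hL'⟩ := T.exists_gradient_bound z'
  simp only [dotProduct, mulVec, Finset.sum_mul]
  refine integrable_finsetSum _ fun i _ => integrable_finsetSum _ fun j _ => ?_
  refine Integrable.of_bound (C := K * L * L') ?_ ?_
  · exact (((ha.aemeasurable i j).mul (measurable_gradient_apply _ j).aemeasurable).mul
      (measurable_gradient_apply _ i).aemeasurable).aestronglyMeasurable
  · filter_upwards [hK, hL, hL'] with x h1 h2 h3
    rw [norm_mul, norm_mul, Real.norm_eq_abs, Real.norm_eq_abs, Real.norm_eq_abs]
    have hK0 := (abs_nonneg _).trans (h1 i j)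
    have hL0 := (abs_nonneg _).trans (h2 j)
    gcongr
    exacts [h1 i j, h2 j, h3 i]

theorem stiffness_isSymm {a : Space d → Matrix (Fin d) (Fin d) ℝ}
    (ha : IsDiffusionCoefficient Ω a) : (T.stiffness a).IsSymm := by
  ext z z'
  rw [Matrix.transpose_apply, stiffness, Matrix.of_apply, Matrix.of_apply]
  refine integral_congr_ae ?_
  filter_upwards [ha.symm] with x hx
  rw [dotProduct_comm, mulVec_dotProduct_comm hx, dotProduct_comm]

theorem ae_sum_stiffness (a : Space d → Matrix (Fin d) (Fin d) ℝ) (v : T.Node → ℝ) :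
    ∀ᵐ x ∂(volume.restrict Ω), ∑ z, ∑ z', v z * (v z' *
      ((a x *ᵥ (gradient (T.hat z) x).ofLp) ⬝ᵥ (gradient (T.hat z') x).ofLp)) =
      (a x *ᵥ (gradient (T.interp v) x).ofLp) ⬝ᵥ (gradient (T.interp v) x).ofLp := by
  filter_upwards [T.ae_mem_interior_simplex] with x hx
  obtain ⟨t, ht, hc, hxt⟩ := hx
  rw [T.gradient_interp ht hc hxt, WithLp.ofLp_sum, mulVec_sum, sum_dotProduct]
  refine Finset.sum_congr rfl fun z _ => ?_
  rw [dotProduct_sum]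
  refine Finset.sum_congr rfl fun z' _ => ?_
  simp only [WithLp.ofLp_smul, mulVec_smul, smul_dotProduct, dotProduct_smul, smul_eq_mul]
  ring

theorem integrable_energy (hΩ : Bornology.IsBounded Ω)
    {a : Space d → Matrix (Fin d) (Fin d) ℝ} (ha : IsDiffusionCoefficient Ω a)
    (v : T.Node → ℝ) :
    Integrable (fun x => (a x *ᵥ (gradient (T.interp v) x).ofLp) ⬝ᵥ
      (gradient (T.interp v) x).ofLp) (volume.restrict Ω) :=
  (integrable_finsetSum _ fun z _ => integrable_finsetSum _ fun z' _ =>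
    ((T.integrable_stiffness hΩ ha z z').const_mul (v z')).const_mul (v z)).congr
    (T.ae_sum_stiffness a v)

theorem dotProduct_stiffness_mulVec (hΩ : Bornology.IsBounded Ω)
    {a : Space d → Matrix (Fin d) (Fin d) ℝ} (ha : IsDiffusionCoefficient Ω a)
    (v : T.Node → ℝ) :
    v ⬝ᵥ (T.stiffness a *ᵥ v) = ∫ x in Ω, (a x *ᵥ (gradient (T.interp v) x).ofLp) ⬝ᵥ
      (gradient (T.interp v) x).ofLp := by
  have hint := fun z z' : T.Node =>
    ((T.integrable_stiffness hΩ ha z z').const_mul (v z')).const_mul (v z)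
  rw [← integral_congr_ae (T.ae_sum_stiffness a v),
    integral_finsetSum _ fun z _ => integrable_finsetSum _ fun z' _ => hint z z']
  have hsum : ∀ S : Matrix T.Node T.Node ℝ,
      v ⬝ᵥ (S *ᵥ v) = ∑ z, ∑ z', v z * (v z' * S z z') := fun S => by
    simp only [dotProduct, mulVec, Finset.mul_sum]
    exact Finset.sum_congr rfl fun z _ => Finset.sum_congr rfl fun z' _ => by ring
  rw [hsum]
  refine Finset.sum_congr rfl fun z _ => ?_
  rw [integral_finsetSum _ fun z' _ => hint z z']
  refine Finset.sum_congr rfl fun z' _ => ?_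
  rw [integral_const_mul, integral_const_mul, stiffness, Matrix.of_apply]

theorem ofLp_dotProduct_self (y : Space d) : y.ofLp ⬝ᵥ y.ofLp = ‖y‖ ^ 2 := by
  rw [EuclideanSpace.norm_sq_eq]
  simp [dotProduct, sq]

theorem integrable_norm_gradient_sq (hΩ : Bornology.IsBounded Ω) (v : T.Node → ℝ) :
    Integrable (fun x => ‖gradient (T.interp v) x‖ ^ 2) (volume.restrict Ω) := by
  have := T.integrable_energy hΩ (IsDiffusionCoefficient.one Ω) v
  simpa only [one_mulVec, ofLp_dotProduct_self] using this

theorem mul_integral_gradient_le (hΩ : Bornology.IsBounded Ω)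
    {a : Space d → Matrix (Fin d) (Fin d) ℝ} (ha : IsDiffusionCoefficient Ω a) {lo : ℝ}
    (hlo : ∀ᵐ x ∂(volume.restrict Ω), ∀ ξ : Fin d → ℝ, lo * (ξ ⬝ᵥ ξ) ≤ ξ ⬝ᵥ (a x *ᵥ ξ))
    (v : T.Node → ℝ) :
    lo * ∫ x in Ω, ‖gradient (T.interp v) x‖ ^ 2 ≤ v ⬝ᵥ (T.stiffness a *ᵥ v) := by
  rw [T.dotProduct_stiffness_mulVec hΩ ha, ← integral_const_mul]
  refine integral_mono_ae ((T.integrable_norm_gradient_sq hΩ v).const_mul lo)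
    (T.integrable_energy hΩ ha v) ?_
  filter_upwards [hlo] with x hx
  rw [← ofLp_dotProduct_self, dotProduct_comm (a x *ᵥ _)]
  exact hx _

/-! ### The lumping error -/

theorem integrable_mass (hΩo : IsOpen Ω) (hΩ : Bornology.IsBounded Ω) (z z' : T.Node) :
    Integrable (fun x => T.hat z x * T.hat z' x) (volume.restrict Ω) := by
  have hfin : IsFiniteMeasure (volume.restrict Ω) :=
    ⟨by rw [Measure.restrict_apply_univ]; exact hΩ.measure_lt_top⟩
  refine Integrable.of_bound (C := 1)
    ((T.continuous_hat hΩo z).mul (T.continuous_hat hΩo z')).aestronglyMeasurable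
    (Filter.Eventually.of_forall fun x => ?_)
  rw [norm_mul, Real.norm_of_nonneg (T.hat_nonneg z x), Real.norm_of_nonneg (T.hat_nonneg z' x)]
  exact mul_le_one₀ (T.hat_le_one z x) (T.hat_nonneg z' x) (T.hat_le_one z' x)

theorem mass_isSymm : T.mass.IsSymm := by
  ext z z'
  simp only [mass, Matrix.transpose_apply, Matrix.of_apply, mul_comm]

/-- Row sums on the diagonal make `M̄ - M` a weighted graph Laplacian; expanding the square and
using the symmetry of `M` gives the identity. -/
theorem dotProduct_lumping_error (v : T.Node → ℝ) :
    v ⬝ᵥ ((T.lumpedMass - T.mass) *ᵥ v) =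
      ∑ z, ∑ z', T.mass z z' * ((1 / 2) * (v z - v z') ^ 2) := by
  have hs : ∑ z, ∑ z', T.mass z z' * v z' ^ 2 = ∑ z, ∑ z', T.mass z z' * v z ^ 2 := by
    rw [Finset.sum_comm]
    refine Finset.sum_congr rfl fun z _ => Finset.sum_congr rfl fun z' _ => ?_
    rw [T.mass_isSymm.apply z z']
  have hR : ∑ z, ∑ z', T.mass z z' * ((1 / 2) * (v z - v z') ^ 2) =
      (1 / 2) * ∑ z, ∑ z', T.mass z z' * v z ^ 2 + (1 / 2) * ∑ z, ∑ z', T.mass z z' * v z' ^ 2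
        - ∑ z, ∑ z', v z * (T.mass z z' * v z') := by
    simp only [Finset.mul_sum, ← Finset.sum_add_distrib, ← Finset.sum_sub_distrib]
    refine Finset.sum_congr rfl fun z _ => Finset.sum_congr rfl fun z' _ => by ring
  rw [hR, hs, sub_mulVec, dotProduct_sub]
  congr 1
  · rw [← add_mul]
    norm_num
    refine Finset.sum_congr rfl fun z _ => ?_
    rw [lumpedMass, mulVec_diagonal, ← Finset.sum_mul]
    ring
  · simp only [dotProduct, mulVec, Finset.mul_sum]

theorem dotProduct_lumping_error_nonneg (v : T.Node → ℝ) :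
    0 ≤ v ⬝ᵥ ((T.lumpedMass - T.mass) *ᵥ v) := by
  rw [T.dotProduct_lumping_error]
  refine Finset.sum_nonneg fun z _ => Finset.sum_nonneg fun z' _ => mul_nonneg ?_ (by positivity)
  exact integral_nonneg fun x => mul_nonneg (T.hat_nonneg z x) (T.hat_nonneg z' x)

/-- The function is affine on the simplex, so its gradient at any single interior point controls all
vertex differences. -/
theorem abs_nodal_sub_le {t : Finset (Space d)} (ht : t ∈ T.complex.faces)
    (hc : t.card = d + 1) {x : Space d} (hx : x ∈ interior (convexHull ℝ (t : Set (Space d))))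
    (v : T.Node → ℝ) {z z' : T.Node} (hz : z.1 ∈ t) (hz' : z'.1 ∈ t) :
    |v z - v z'| ≤ ‖gradient (T.interp v) x‖ * T.meshSize := by
  obtain ⟨g, hg⟩ := T.exists_affine_eqOn_sum_hat ht hc v
  have hg : Set.EqOn (T.interp v) g (convexHull ℝ (t : Set (Space d))) := hg
  have hz1 := subset_convexHull ℝ (t : Set (Space d)) hz
  have hz1' := subset_convexHull ℝ (t : Set (Space d)) hz'
  rw [← T.interp_node v z, ← T.interp_node v z', hg hz1, hg hz1',
    ← inner_gradient_of_eqOn_affine hg hx]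
  refine (abs_real_inner_le_norm _ _).trans (mul_le_mul_of_nonneg_left ?_ (norm_nonneg _))
  rw [← dist_eq_norm]
  exact (Metric.dist_le_diam_of_mem (t.finite_toSet.isCompact_convexHull (𝕜 := ℝ)).isBounded
    hz1 hz1').trans (T.diam_le_meshSize ht)

theorem dotProduct_lumping_error_le (hΩo : IsOpen Ω) (hΩ : Bornology.IsBounded Ω)
    (v : T.Node → ℝ) :
    v ⬝ᵥ ((T.lumpedMass - T.mass) *ᵥ v) ≤
      T.meshSize ^ 2 / 2 * ∫ x in Ω, ‖gradient (T.interp v) x‖ ^ 2 := by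
  have hint := fun z z' : T.Node =>
    (T.integrable_mass hΩo hΩ z z').mul_const ((1 / 2) * (v z - v z') ^ 2)
  have heq : v ⬝ᵥ ((T.lumpedMass - T.mass) *ᵥ v) = ∫ x in Ω, ∑ z, ∑ z',
      T.hat z x * T.hat z' x * ((1 / 2) * (v z - v z') ^ 2) := by
    rw [integral_finsetSum _ fun z _ => integrable_finsetSum _ fun z' _ => hint z z',
      T.dotProduct_lumping_error]
    refine Finset.sum_congr rfl fun z _ => ?_
    rw [integral_finsetSum _ fun z' _ => hint z z']
    refine Finset.sum_congr rfl fun z' _ => ?_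
    rw [integral_mul_const, mass, Matrix.of_apply]
  rw [heq, ← integral_const_mul]
  refine integral_mono_ae
    (integrable_finsetSum _ fun z _ => integrable_finsetSum _ fun z' _ => hint z z')
    ((T.integrable_norm_gradient_sq hΩ v).const_mul _) ?_
  filter_upwards [T.ae_mem_interior_simplex] with x hx
  obtain ⟨t, ht, hc, hxt⟩ := hx
  set G := ‖gradient (T.interp v) x‖ with hG
  calc ∑ z, ∑ z', T.hat z x * T.hat z' x * ((1 / 2) * (v z - v z') ^ 2)
      ≤ ∑ z, ∑ z', T.hat z x * T.hat z' x * (T.meshSize ^ 2 / 2 * G ^ 2) := by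
        refine Finset.sum_le_sum fun z _ => Finset.sum_le_sum fun z' _ => ?_
        by_cases hz : z.1 ∈ t
        · by_cases hz' : z'.1 ∈ t
          · refine mul_le_mul_of_nonneg_left ?_
              (mul_nonneg (T.hat_nonneg z x) (T.hat_nonneg z' x))
            have h1 := T.abs_nodal_sub_le ht hc hxt v hz hz'
            have h2 : (v z - v z') ^ 2 ≤ (G * T.meshSize) ^ 2 := by
              rw [← sq_abs (v z - v z')]
              exact pow_le_pow_left₀ (abs_nonneg _) h1 2
            linarith [mul_pow G T.meshSize 2]
          · simp [T.hat_eq_zero_of_not_mem ht (interior_subset hxt) hz']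
        · simp [T.hat_eq_zero_of_not_mem ht (interior_subset hxt) hz]
    _ = (∑ z, T.hat z x) * (∑ z, T.hat z x) * (T.meshSize ^ 2 / 2 * G ^ 2) := by
        rw [Finset.sum_mul_sum]
        simp only [Finset.sum_mul]
    -- The sum can be less than one because boundary vertices carry no basis function.
    _ ≤ 1 * (T.meshSize ^ 2 / 2 * G ^ 2) := by
        refine mul_le_mul_of_nonneg_right ?_ (by positivity)
        exact mul_le_one₀ (T.sum_hat_le_one x) (Finset.sum_nonneg fun z _ => T.hat_nonneg z x)
          (T.sum_hat_le_one x)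
    _ = T.meshSize ^ 2 / 2 * G ^ 2 := one_mul _

/-! ### Positive definiteness of the stiffness matrix -/

/-- The function is constant on each full simplex, so its extension by zero is continuous on all of
space with finitely many values. Hence it is constant, and it vanishes outside the bounded set `Ω`.
-/
theorem interp_eq_zero_of_gradient (hd : 1 ≤ d) (hΩo : IsOpen Ω) (hΩ : Bornology.IsBounded Ω)
    {v : T.Node → ℝ} (h : ∀ᵐ x ∂(volume.restrict Ω), gradient (T.interp v) x = 0) :
    v = 0 := by
  set u := T.interp v with hu
  have hcont : Continuous u :=
    continuous_finsetSum _ fun z _ => (T.continuous_hat hΩo z).const_mul (v z)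
  have hout : ∀ x, x ∉ Ω → u x = 0 := fun x hx => by
    simp [hu, interp, T.hat_eq_zero_of_not_mem_domain hΩo _ hx]
  have hconst : ∀ t ∈ T.complex.faces, t.card = d + 1 →
      ∃ c, ∀ x ∈ convexHull ℝ (t : Set (Space d)), u x = c := by
    intro t ht hc
    obtain ⟨g, hg⟩ := T.exists_affine_eqOn_sum_hat ht hc v
    have hg : Set.EqOn u g (convexHull ℝ (t : Set (Space d))) := hg
    have hne : (interior (convexHull ℝ (t : Set (Space d)))).Nonempty := by
      rw [interior_convexHull_nonempty_iff_affineSpan_eq_top]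
      have := (T.complex.indep ht).affineSpan_eq_top_iff_card_eq_finrank_add_one.2
        (by simp [hc])
      simpa using this
    have hne2 : (interior (convexHull ℝ (t : Set (Space d))) ∩ Ω).Nonempty := by
      obtain ⟨y, hy⟩ := hne
      have hyc : y ∈ closure Ω := by
        rw [← T.space_eq]
        exact T.complex.convexHull_subset_space ht (interior_subset hy)
      exact mem_closure_iff.1 hyc _ isOpen_interior hy
    -- A nonempty open set has positive measure, so it contains a point where the almost everywhere
    -- hypothesis holds.
    obtain ⟨x, hx, hgx⟩ : ∃ x ∈ interior (convexHull ℝ (t : Set (Space d))) ∩ Ω,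
        gradient u x = 0 := by
      by_contra! hcon
      have hpos := (isOpen_interior.inter hΩo).measure_pos volume hne2
      refine hpos.ne' (measure_mono_null (t := {x | ¬ (x ∈ Ω → gradient u x = 0)}) ?_ ?_)
      · intro x hx h'
        exact hcon x hx (h' hx.2)
      · exact (ae_restrict_iff' hΩo.measurableSet).1 h
    refine ⟨g x, fun y hy => ?_⟩
    have := inner_gradient_of_eqOn_affine hg hx.1 y x
    rw [hgx, inner_zero_left] at this
    rw [hg hy]
    linarith
  choose! c hc using hconst
  have hrange : (Set.range u).Finite := by
    refine ((T.finite_faces.image c).insert 0).subset ?_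
    rintro _ ⟨x, rfl⟩
    by_cases hx : x ∈ Ω
    · obtain ⟨t, ht, hcard, hxt⟩ := T.exists_full_simplex (subset_closure hx)
      exact Or.inr ⟨t, ht, (hc t ht hcard x hxt).symm⟩
    · exact Or.inl (hout x hx)
  have : Nonempty (Fin d) := ⟨⟨0, hd⟩⟩
  obtain ⟨y, hy⟩ : ∃ y, y ∉ Ω := by
    by_contra! hall
    exact NormedSpace.unbounded_univ ℝ (Space d) (hΩ.subset fun x _ => hall x)
  funext z
  rw [← T.interp_node v z, Pi.zero_apply, ← hout y hy]
  exact isPreconnected_univ.constant_of_mapsTo hrange.isDiscrete hcont.continuousOn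
    (fun x _ => Set.mem_range_self x) (Set.mem_univ _) (Set.mem_univ _)

theorem dotProduct_stiffness_pos (hd : 1 ≤ d) (hΩo : IsOpen Ω) (hΩ : Bornology.IsBounded Ω)
    {a : Space d → Matrix (Fin d) (Fin d) ℝ} (ha : IsDiffusionCoefficient Ω a)
    {v : T.Node → ℝ} (hv : v ≠ 0) : 0 < v ⬝ᵥ (T.stiffness a *ᵥ v) := by
  obtain ⟨lo, hi, hlo, h⟩ := ha.elliptic
  refine lt_of_lt_of_le (mul_pos hlo ?_)
    (T.mul_integral_gradient_le hΩ ha (h.mono fun x hx ξ => (hx ξ).1) v)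
  have hnn : 0 ≤ ∫ x in Ω, ‖gradient (T.interp v) x‖ ^ 2 := integral_nonneg fun x => by positivity
  refine hnn.lt_of_ne fun h0 => hv (T.interp_eq_zero_of_gradient hd hΩo hΩ ?_)
  have := (integral_eq_zero_iff_of_nonneg (fun x => by positivity)
    (T.integrable_norm_gradient_sq hΩ v)).1 h0.symm
  filter_upwards [this] with x hx
  simpa using hx

end Triangulation

/-! ### The preconditioned saddle point matrix -/

section SaddlePoint

variable {ι : Type} [Fintype ι] [DecidableEq ι]

/-- The preconditioned saddle point matrix differs from the identity by a matrix of spectral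
radius at most `c`. -/
theorem rho_one_sub_saddle_le {A B L M : Matrix ι ι ℝ} (hA : A.IsSymm) (hB : B.IsSymm)
    (hM : M.IsSymm) (hL : L.IsSymm) (hA0 : ∀ x : ι → ℝ, x ≠ 0 → 0 < x ⬝ᵥ (A *ᵥ x))
    (hB0 : ∀ x : ι → ℝ, x ≠ 0 → 0 < x ⬝ᵥ (B *ᵥ x))
    (hD0 : ∀ x : ι → ℝ, 0 ≤ x ⬝ᵥ ((L - M) *ᵥ x)) {c : ℝ} (hc : 0 ≤ c)
    (hDA : ∀ x : ι → ℝ, x ⬝ᵥ ((L - M) *ᵥ x) ≤ c * (x ⬝ᵥ (A *ᵥ x)))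
    (hDB : ∀ x : ι → ℝ, x ⬝ᵥ ((L - M) *ᵥ x) ≤ c * (x ⬝ᵥ (B *ᵥ x)))
    (hdet : IsUnit (fromBlocks A L L (-B)).det) :
    rho (1 - (fromBlocks A L L (-B))⁻¹ * fromBlocks A M M (-B)) ≤ c := by
  refine rho_le hc fun l hl => ?_
  obtain ⟨x, hx, h⟩ := exists_mulVec_eq_smul_of_mem_spectrum hl
  set P := fromBlocks A L L (-B) with hP
  -- The diagonal blocks cancel, so multiplying the eigenvalue equation by `P` gives the pencil with
  -- off-diagonal blocks `L - M`.
  have hPE : P * (1 - P⁻¹ * fromBlocks A M M (-B)) = fromBlocks 0 (L - M) (L - M) 0 := by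
    rw [mul_sub, mul_one, ← mul_assoc, Matrix.mul_nonsing_inv _ hdet, one_mul, hP, sub_eq_add_neg,
      fromBlocks_neg, fromBlocks_add]
    simp [sub_eq_add_neg]
  have hmul : ∀ X Y : Matrix (ι ⊕ ι) (ι ⊕ ι) ℝ, (X * Y).map ((↑) : ℝ → ℂ) =
      X.map ((↑) : ℝ → ℂ) * Y.map ((↑) : ℝ → ℂ) := fun X Y =>
    map_mul (Complex.ofRealHom.mapMatrix (m := ι ⊕ ι)) X Y
  have h1 : (fromBlocks 0 (L - M) (L - M) 0 : Matrix (ι ⊕ ι) (ι ⊕ ι) ℝ).map ((↑) : ℝ → ℂ) *ᵥ x =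
      l • (P.map ((↑) : ℝ → ℂ) *ᵥ x) := by
    rw [← hPE, hmul, ← mulVec_mulVec, h, mulVec_smul]
  rw [hP, fromBlocks_map, fromBlocks_map, fromBlocks_mulVec, fromBlocks_mulVec] at h1
  have hz : (0 : Matrix ι ι ℝ).map ((↑) : ℝ → ℂ) = 0 := by ext; simp
  have hneg : (-B).map ((↑) : ℝ → ℂ) = -B.map ((↑) : ℝ → ℂ) := by ext; simp
  rw [hz, zero_mulVec, zero_mulVec, zero_add, add_zero, hneg, neg_mulVec] at h1
  refine norm_le_of_saddle_pencil (p := x ∘ Sum.inl) (q := x ∘ Sum.inr) hA hB (hL.sub hM) hL hA0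
    hB0 hD0 hDA hDB ?_ ?_ ?_
  · by_contra! hcon
    refine hx (funext fun i => ?_)
    rcases i with i | i
    · exact congrFun hcon.1 i
    · exact congrFun hcon.2 i
  · exact funext fun i => congrFun h1 (Sum.inl i)
  · rw [sub_eq_add_neg]
    exact funext fun i => congrFun h1 (Sum.inr i)

theorem isUnit_det_saddle {A B L : Matrix ι ι ℝ} (hL : L.IsSymm)
    (hA0 : ∀ x : ι → ℝ, x ≠ 0 → 0 < x ⬝ᵥ (A *ᵥ x))
    (hB0 : ∀ x : ι → ℝ, x ≠ 0 → 0 < x ⬝ᵥ (B *ᵥ x)) : IsUnit (fromBlocks A L L (-B)).det := by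
  rw [isUnit_iff_ne_zero]
  intro h
  obtain ⟨x, hx, h0⟩ := Matrix.exists_mulVec_eq_zero_iff.2 h
  exact hx (saddle_mulVec_eq_zero hL hA0 hB0 h0)

end SaddlePoint

/-! ### Constants, threshold and convergence of GMRes -/

theorem euclNorm_nonneg {n : Type} [Fintype n] (x : n → ℝ) : 0 ≤ euclNorm x := norm_nonneg _

theorem condNumber_nonneg {n : Type} [Fintype n] [DecidableEq n] (V : Matrix n n ℂ) :
    0 ≤ condNumber V := mul_nonneg (norm_nonneg _) (norm_nonneg _)

/-- The constant of the residual bound dominates the one from the scaled Jordan form. -/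
theorem JordanTransform.condNumber_mul_pow_le {n : Type} [Fintype n] [DecidableEq n] [Nonempty n]
    {R : Matrix n n ℝ} (J : JordanTransform R) (hn : 2 ≤ Fintype.card n) {ρE N : ℝ}
    (h0 : 0 ≤ ρE) (h1 : ρE < 1) (hN : 1 ≤ N) :
    condNumber J.V * 3 ^ (J.m - 1) ≤
      2 ^ (J.m - 1) * J.CR ^ J.m * (1 + ρE) * N / (1 - ρE) ^ J.m := by
  have hκ := one_le_condNumber J.isUnit_det
  obtain ⟨k, hk⟩ : ∃ k, J.m = k + 1 := ⟨J.m - 1, by have := J.one_le_m; omega⟩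
  -- With `κ ≥ 1` this gives `2^(m-1) C_R^m ≥ 2 · 4^(m-1) κ`, which leaves room for `3^(m-1) κ`; the
  -- remaining factors of `C₀` only help.
  have hCR : 2 * condNumber J.V ≤ J.CR := by
    have hn' : (2 : ℝ) ≤ Fintype.card n := by exact_mod_cast hn
    have hs := Real.sqrt_nonneg ((Fintype.card n : ℝ) - (J.p : ℝ))
    refine mul_le_mul_of_nonneg_right ?_ (condNumber_nonneg _)
    nlinarith
  rw [hk, Nat.add_sub_cancel, le_div_iff₀ (pow_pos (by linarith) _)]
  have h2 : 2 ^ (k + 1) * condNumber J.V ≤ J.CR ^ (k + 1) :=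
    calc 2 ^ (k + 1) * condNumber J.V ≤ 2 ^ (k + 1) * condNumber J.V ^ (k + 1) := by
          refine mul_le_mul_of_nonneg_left ?_ (by positivity)
          exact le_self_pow₀ hκ (by omega)
      _ = (2 * condNumber J.V) ^ (k + 1) := (mul_pow _ _ _).symm
      _ ≤ J.CR ^ (k + 1) := pow_le_pow_left₀ (by linarith) hCR _
  have hCR0 : 0 ≤ J.CR := by linarith
  calc condNumber J.V * 3 ^ k * (1 - ρE) ^ (k + 1)
      ≤ condNumber J.V * 3 ^ k * 1 := by
        refine mul_le_mul_of_nonneg_left (pow_le_one₀ (by linarith) (by linarith)) ?_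
        have := condNumber_nonneg J.V
        positivity
    _ ≤ condNumber J.V * 4 ^ k * 2 := by
        have := condNumber_nonneg J.V
        have h34 : (3 : ℝ) ^ k ≤ 4 ^ k := pow_le_pow_left₀ (by norm_num) (by norm_num) k
        have := mul_le_mul_of_nonneg_left h34 this
        have : 0 ≤ condNumber J.V * 4 ^ k := by positivity
        linarith
    _ = 2 ^ k * (2 ^ (k + 1) * condNumber J.V) := by
        have : (4 : ℝ) ^ k = 2 ^ k * 2 ^ k := by rw [← mul_pow]; norm_num
        rw [this, pow_succ]
        ring
    _ ≤ 2 ^ k * J.CR ^ (k + 1) := mul_le_mul_of_nonneg_left h2 (by positivity)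
    _ ≤ 2 ^ k * J.CR ^ (k + 1) * (1 + ρE) * N := by
        rw [mul_assoc (2 ^ k * J.CR ^ (k + 1))]
        exact le_mul_of_one_le_right (by positivity) (one_le_mul_of_one_le_of_one_le
          (by linarith) hN)

/-- The factor `6 / lo` is chosen so that `h²/2 ≤ τ lo / 12`. -/
theorem Triangulation.dotProduct_lumping_error_le_stiffness {d : ℕ} {Ω : Set (Space d)}
    (T : Triangulation Ω) (hΩo : IsOpen Ω) (hΩ : Bornology.IsBounded Ω)
    {a : Space d → Matrix (Fin d) (Fin d) ℝ} (ha : IsDiffusionCoefficient Ω a) {lo τ : ℝ}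
    (hlo0 : 0 < lo)
    (hlo : ∀ᵐ x ∂(volume.restrict Ω), ∀ ξ : Fin d → ℝ, lo * (ξ ⬝ᵥ ξ) ≤ ξ ⬝ᵥ (a x *ᵥ ξ))
    (hτ : 6 / lo * T.meshSize ^ 2 ≤ τ) (v : T.Node → ℝ) :
    v ⬝ᵥ ((T.lumpedMass - T.mass) *ᵥ v) ≤ 1 / 12 * (v ⬝ᵥ ((τ • T.stiffness a) *ᵥ v)) := by
  have h1 := T.dotProduct_lumping_error_le hΩo hΩ v
  have h2 := T.mul_integral_gradient_le hΩ ha hlo v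
  have hnn : 0 ≤ ∫ x in Ω, ‖gradient (T.interp v) x‖ ^ 2 :=
    integral_nonneg fun x => by positivity
  rw [smul_mulVec, dotProduct_smul, smul_eq_mul]
  have hτ0 : 0 ≤ τ := le_trans (by positivity) hτ
  have h3 : 6 * T.meshSize ^ 2 ≤ τ * lo := by
    rw [div_mul_eq_mul_div, div_le_iff₀ hlo0] at hτ
    exact hτ
  have h4 := mul_le_mul_of_nonneg_left h2 hτ0
  have h5 := mul_le_mul_of_nonneg_right h3 hnn
  linarith

/-- Above the threshold `τ ≥ C h²` the preconditioned matrix is close to the identity. -/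
theorem exists_lumping_threshold {d : ℕ} (hd : 1 ≤ d)
    {Ω : Set (Space d)} (hΩ_open : IsOpen Ω) (hΩ_bdd : Bornology.IsBounded Ω)
    {a b : Space d → Matrix (Fin d) (Fin d) ℝ} (ha : IsDiffusionCoefficient Ω a)
    (hb : IsDiffusionCoefficient Ω b) :
    ∃ C : ℝ, 0 < C ∧ ∀ (T : Triangulation Ω) (τ : ℝ), 0 < τ → C * T.meshSize ^ 2 ≤ τ →
      IsUnit (T.preconditioner a b τ).det ∧
      rho (1 - (T.preconditioner a b τ)⁻¹ * T.systemMatrix a b τ) ≤ 1 / 12 := by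
  obtain ⟨la, _, hla, ha'⟩ := ha.elliptic
  obtain ⟨lb, _, hlb, hb'⟩ := hb.elliptic
  -- The sum dominates the thresholds of both coefficients.
  refine ⟨6 / la + 6 / lb, by positivity, fun T τ hτ hC => ?_⟩
  rw [add_mul] at hC
  have hCa : 6 / la * T.meshSize ^ 2 ≤ τ := le_trans (le_add_of_nonneg_right (by positivity)) hC
  have hCb : 6 / lb * T.meshSize ^ 2 ≤ τ := le_trans (le_add_of_nonneg_left (by positivity)) hC
  have hpos : ∀ {a : Space d → Matrix (Fin d) (Fin d) ℝ}, IsDiffusionCoefficient Ω a →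
      ∀ x : T.Node → ℝ, x ≠ 0 → 0 < x ⬝ᵥ ((τ • T.stiffness a) *ᵥ x) := fun ha x hx => by
    rw [smul_mulVec, dotProduct_smul, smul_eq_mul]
    exact mul_pos hτ (T.dotProduct_stiffness_pos hd hΩ_open hΩ_bdd ha hx)
  have hL : T.lumpedMass.IsSymm := Matrix.isSymm_diagonal _
  have hdet := isUnit_det_saddle hL (hpos ha) (hpos hb)
  exact ⟨hdet, rho_one_sub_saddle_le ((T.stiffness_isSymm ha).smul τ)
    ((T.stiffness_isSymm hb).smul τ) T.mass_isSymm hL (hpos ha) (hpos hb)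
    T.dotProduct_lumping_error_nonneg (by norm_num)
    (T.dotProduct_lumping_error_le_stiffness hΩ_open hΩ_bdd ha hla
      (ha'.mono fun x hx ξ => (hx ξ).1) hCa)
    (T.dotProduct_lumping_error_le_stiffness hΩ_open hΩ_bdd hb hlb
      (hb'.mono fun x hx ξ => (hx ξ).1) hCb) hdet⟩

open scoped Matrix.Norms.L2Operator in
/-- Convergence of GMRes for a right preconditioner with `ρ(1 - ℬ⁻¹𝒜) ≤ 1/12`. -/
theorem IsGMRes.convergence {n : Type} [Fintype n] [DecidableEq n] {𝒜 ℬ : Matrix n n ℝ}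
    (hdet : IsUnit ℬ.det) (hρ : rho (1 - ℬ⁻¹ * 𝒜) ≤ 1 / 12) {N : ℝ}
    (hN : Nonempty n → 2 ≤ Fintype.card n ∧ 1 ≤ N) {f : n → ℝ} {v : ℕ → n → ℝ} {r : ℕ → ℝ}
    (hv : IsGMRes (𝒜 * ℬ⁻¹) f v) (hr : ∀ k, r k = euclNorm (f - (𝒜 * ℬ⁻¹) *ᵥ v k)) :
    asymptoticRate r ≤ ENNReal.ofReal (rho (ℬ⁻¹ * 𝒜) / 2) ∧
      ∀ (J : JordanTransform (𝒜 * ℬ⁻¹)) (k : ℕ),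
        r k ≤ (2 ^ (J.m - 1) * J.CR ^ J.m * (1 + rho (1 - ℬ⁻¹ * 𝒜)) * N
          / (1 - rho (1 - ℬ⁻¹ * 𝒜)) ^ J.m) * (rho (ℬ⁻¹ * 𝒜) / 2) ^ k * r 0 := by
  have hρ0 := rho_nonneg (1 - ℬ⁻¹ * 𝒜)
  have hconj : 1 - 𝒜 * ℬ⁻¹ = ℬ * (1 - ℬ⁻¹ * 𝒜) * ℬ⁻¹ := by
    rw [mul_sub, mul_one, sub_mul, ← mul_assoc, Matrix.mul_nonsing_inv _ hdet, one_mul]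
  have hρR : rho (1 - 𝒜 * ℬ⁻¹) = rho (1 - ℬ⁻¹ * 𝒜) := by rw [hconj, rho_conj hdet]
  have hrnn : ∀ k, 0 ≤ r k := fun k => by
    rw [hr]
    exact euclNorm_nonneg _
  have hpow : ∀ k, r k ≤ ‖(1 - 𝒜 * ℬ⁻¹).map ((↑) : ℝ → ℂ) ^ k‖ * r 0 := fun k => by
    rw [hr, hr 0]
    exact (hv.residual_le k).trans (euclNorm_pow_mulVec_le _ k _)
  -- With no unknowns all residuals vanish; this case is separate because `θ` is then `0` and has no
  -- lower bound `11/24`.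
  cases isEmpty_or_nonempty n
  · have hr0 : ∀ k, r k = 0 := fun k => by
      rw [hr, Subsingleton.elim (f - (𝒜 * ℬ⁻¹) *ᵥ v k) 0]
      simp [euclNorm]
    refine ⟨(asymptoticRate_le_of_residual_le hrnn hpow).trans
      (ENNReal.ofReal_le_ofReal ?_), fun J k => by rw [hr0, hr0, mul_zero]⟩
    refine (rho_le le_rfl fun l hl => ?_).trans (div_nonneg (rho_nonneg _) two_pos.le)
    obtain ⟨x, hx, -⟩ := exists_mulVec_eq_smul_of_mem_spectrum hl
    exact absurd (Subsingleton.elim x 0) hx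
  · obtain ⟨hcard, hN1⟩ := hN inferInstance
    have hlow := one_sub_rho_le (ℬ⁻¹ * 𝒜)
    refine ⟨(asymptoticRate_le_of_residual_le hrnn hpow).trans
      (ENNReal.ofReal_le_ofReal (by rw [hρR]; linarith)), fun J k => ?_⟩
    have hC0 := J.condNumber_mul_pow_le hcard hρ0 (by linarith) hN1
    -- The choice `δ = 1/3` keeps `1/12 + δ = 5/12` below `11/24 = (1 - 1/12)/2 ≤ θ`, at the cost of
    -- the factor `3^(m-1)`.
    have hJ := J.norm_one_sub_pow_le (q := 1 / 12) (δ := 1 / 3) (by norm_num) (by norm_num)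
      (by rw [hρR]; exact hρ) k
    have hκ := condNumber_nonneg J.V
    refine (hpow k).trans (mul_le_mul_of_nonneg_right (hJ.trans ?_) (hrnn 0))
    have h3 : ((1 : ℝ) / 3)⁻¹ = 3 := by norm_num
    rw [h3]
    have hθk : ((1 : ℝ) / 12 + 1 / 3) ^ k ≤ (rho (ℬ⁻¹ * 𝒜) / 2) ^ k :=
      pow_le_pow_left₀ (by norm_num) (by linarith) k
    have hle : 0 ≤ condNumber J.V * 3 ^ (J.m - 1) := by positivity
    exact mul_le_mul hC0 hθk (by positivity) (hle.trans hC0)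

end FourthOrderFEM

end

theorem mainTheorem2 (d : ℕ) (hd : 1 ≤ d)
    (Ω : Set (FourthOrderFEM.Space d)) (hΩ_open : IsOpen Ω) (hΩ_conn : IsConnected Ω)
    (hΩ_bdd : Bornology.IsBounded Ω)
    (a b : FourthOrderFEM.Space d → Matrix (Fin d) (Fin d) ℝ)
    (ha : FourthOrderFEM.IsDiffusionCoefficient Ω a)
    (hb : FourthOrderFEM.IsDiffusionCoefficient Ω b) (σ : ℝ) :
    ∃ C : ℝ, 0 < C ∧
      ∀ T : FourthOrderFEM.Triangulation Ω, T.IsShapeRegular σ →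
      ∀ τ : ℝ, 0 < τ → C * T.meshSize ^ 2 ≤ τ →
      ∀ 𝒜 ℬ : Matrix (T.Node ⊕ T.Node) (T.Node ⊕ T.Node) ℝ,
        𝒜 = T.systemMatrix a b τ → ℬ = T.preconditioner a b τ →
      ∀ θ ρE : ℝ, θ = FourthOrderFEM.rho (ℬ⁻¹ * 𝒜) / 2 →
        ρE = FourthOrderFEM.rho (1 - ℬ⁻¹ * 𝒜) →
      IsUnit ℬ.det ∧ θ < 1 ∧ ρE < 1 ∧
      ∀ (f : T.Node ⊕ T.Node → ℝ) (v : ℕ → T.Node ⊕ T.Node → ℝ) (r : ℕ → ℝ),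
        FourthOrderFEM.IsGMRes (𝒜 * ℬ⁻¹) f v →
        (∀ k, r k = FourthOrderFEM.euclNorm (f - (𝒜 * ℬ⁻¹).mulVec (v k))) →
        FourthOrderFEM.asymptoticRate r ≤ ENNReal.ofReal θ ∧
        ∀ (J : FourthOrderFEM.JordanTransform (𝒜 * ℬ⁻¹)) (k : ℕ),
          r k ≤ (2 ^ (J.m - 1) * J.CR ^ J.m * (1 + ρE) * (Module.finrank ℝ T.feSpace : ℝ)
            / (1 - ρE) ^ J.m) * θ ^ k * r 0 := by
  obtain ⟨C, hC0, hC⟩ := FourthOrderFEM.exists_lumping_threshold hd hΩ_open hΩ_bdd ha hb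
  refine ⟨C, hC0, fun T _ τ hτ hCτ 𝒜 ℬ h𝒜 hℬ θ ρE hθ hρE => ?_⟩
  obtain ⟨hdet, hρ⟩ := hC T τ hτ hCτ
  rw [← h𝒜, ← hℬ] at hρ
  rw [← hℬ] at hdet
  -- With `ρ(E) ≤ 1/12` this gives `θ ≤ 13/24 < 1`.
  have hup := FourthOrderFEM.rho_le_one_add (ℬ⁻¹ * 𝒜)
  subst hθ hρE
  refine ⟨hdet, by linarith, by linarith, fun f v r hv hr => hv.convergence hdet hρ ?_ hr⟩
  intro hne
  have : Nonempty T.Node := hne.elim fun i => i.elim Nonempty.intro Nonempty.intro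
  have hcard : 0 < Fintype.card T.Node := Fintype.card_pos
  refine ⟨by rw [Fintype.card_sum]; omega, ?_⟩
  exact_mod_cast T.finrank_feSpace_pos hΩ_open
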